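/- Let $0<\gamma<1$ and $b>0$, and consider the zero-range process with jump rates $g(0)=0$, $g(n)=1+b\,n^{-\gamma}$ for $n\ge 1$. Put $w(n)=\prod_{k=1}^n g(k)^{-1}$, $Z(L,N)=\sum_{\eta\in\mathbb N_0^L,\ \sum_x\eta_x=N}\ \prod_{x=1}^L w(\eta_x)$, and let $j_{L,N}=Z(L,N-1)/Z(L,N)$ be the canonical current. Let $\rho_c$ and $\sigma_c^2$ be the mean and the variance of the critical single-site distribution $n\mapsto w(n)/\sum_{k\ge 0}w(k)$ on $\mathbb N_0$. Put $\alpha=\frac{\gamma}{1+\gamma}$, $$\delta\rho_{\rm trans}=\sigma_c^{\frac{2}{1+\gamma}}(1+\gamma)(2\gamma)^{-\frac{\gamma}{1+\gamma}}\Big(\frac{b}{1-\gamma}\Big)^{\frac1{1+\gamma}},$$ and, for $\delta\rho>0$ and $0\le r\le\delta\rho$, define the scaling rate function $$I_{\delta\rho}(r)=\frac{r^2}{2\sigma_c^2}+\frac{b}{1-\gamma}(\delta\rho-r)^{1-\gamma}-\inf_{s\in(0,\delta\rho)}\Big\{\frac{s^2}{2\sigma_c^2}+\frac{b}{1-\gamma}(\delta\rho-s)^{1-\gamma}\Big\}.$$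 Let $\delta\rho>0$ and let $N=N_L$ be any sequence of particle numbers with $N_L=\rho_cL+\delta\rho\,L^{1-\alpha}+o(L^{1-\alpha})$ as $L\to\infty$. (1) If $\delta\rho<\delta\rho_{\rm trans}$, then $j_{L,N_L}-1=L^{-\alpha}\,\dfrac{\delta\rho}{\sigma_c^2}+o(L^{-\alpha})$. (2) If $\delta\rho>\delta\rho_{\rm trans}$, then $I_{\delta\rho}$ has exactly one local minimum $r_0=r_0(\delta\rho)$ in the open interval $(0,\delta\rho)$ (the condensed local minimum), and $j_{L,N_L}-1=\dfrac{b\,L^{-\alpha}}{(\delta\rho-r_0)^{\gamma}}+o(L^{-\alpha})$. (3) Consequently the rescaled current overshoot is discontinuous on the critical scale: for every $\delta\rho\in(0,\infty)\setminus\{\delta\rho_{\rm trans}\}$ the limit $J(\delta\rho)=\lim_{L\to\infty}L^{\alpha}(j_{L,N_L}-1)$ exists and depends only on $\delta\rho$ (for fixed $\gamma$, $b$), and the one-sided limits of $J$ at $\delta\rho_{\rm trans}$ exist and satisfy $J(\delta\rho_{\rm trans}-)>J(\delta\rho_{\rm trans}+)$. -/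

import Mathlib

open Filter Topology Asymptotics

noncomputable section

namespace ZeroRange

/-- Jump rates: `g 0 = 0` and `g n = 1 + b / n ^ γ` for `n > 0`. -/
def rate (γ b : ℝ) (n : ℕ) : ℝ := if n = 0 then 0 else 1 + b / (n : ℝ) ^ γ

/-- Stationary weights `w n = ∏_{k=1}^n g(k)⁻¹`, with `w 0 = 1`. -/
def weight (γ b : ℝ) (n : ℕ) : ℝ := ∏ k ∈ Finset.Icc 1 n, (rate γ b k)⁻¹

/-- Canonical partition function `Z(L, N)`: the sum, over all configurations of `N` particles on
`L` sites, of the product of the single-site weights. -/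
def partitionZ (γ b : ℝ) (L N : ℕ) : ℝ :=
  ∑ η ∈ Finset.piAntidiag (Finset.univ : Finset (Fin L)) N, ∏ x, weight γ b (η x)

/-- Canonical current `j_{L,N} = Z(L, N - 1) / Z(L, N)` (used for `N ≥ 1`). -/
def current (γ b : ℝ) (L N : ℕ) : ℝ := partitionZ γ b L (N - 1) / partitionZ γ b L N

/-- The single-site partition function at the critical fugacity `φ_c = 1`. -/
def critZ (γ b : ℝ) : ℝ := ∑' n : ℕ, weight γ b n

/-- The critical single-site distribution `ν_{φ_c}[n] = w(n) / z(1)`. -/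
def critProb (γ b : ℝ) (n : ℕ) : ℝ := weight γ b n / critZ γ b

/-- Critical density `ρ_c`: the mean of the critical single-site distribution. -/
def rhoC (γ b : ℝ) : ℝ := ∑' n : ℕ, (n : ℝ) * critProb γ b n

/-- Critical variance `σ_c²` of the critical single-site distribution. -/
def varC (γ b : ℝ) : ℝ := (∑' n : ℕ, (n : ℝ) ^ 2 * critProb γ b n) - rhoC γ b ^ 2

/-- The scaling exponent `α = γ / (1 + γ)`. -/
def scaleExp (γ : ℝ) : ℝ := γ / (1 + γ)

/-- The particle numbers `N L` are on the critical scale with parameter `d = δρ`: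
`N = ρ_c L + δρ L^{1-α} + o(L^{1-α})` as `L → ∞`. -/
def AtCriticalScale (γ b d : ℝ) (N : ℕ → ℕ) : Prop :=
  (fun L : ℕ => (N L : ℝ) - (rhoC γ b * (L : ℝ) + d * (L : ℝ) ^ (1 - scaleExp γ)))
    =o[atTop] (fun L : ℕ => (L : ℝ) ^ (1 - scaleExp γ))

/-- The rate function before normalisation,
`r² / (2 σ_c²) + b / (1 - γ) * (δρ - r)^{1-γ}`, with `d = δρ`. -/
def rateFunAux (γ b d r : ℝ) : ℝ :=
  r ^ 2 / (2 * varC γ b) + b / (1 - γ) * (d - r) ^ (1 - γ)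

/-- The scaling rate function `I^{(2)}_{δρ}(r)`, with `d = δρ`; it is meant for `0 ≤ r ≤ d`. -/
def rateFun (γ b d r : ℝ) : ℝ :=
  rateFunAux γ b d r - sInf (rateFunAux γ b d '' Set.Ioo 0 d)

/-- The transition point
`δρ_trans = σ_c^{2/(1+γ)} (1+γ) (2γ)^{-γ/(1+γ)} (b/(1-γ))^{1/(1+γ)}`. -/
def dTrans (γ b : ℝ) : ℝ :=
  varC γ b ^ (1 / (1 + γ)) * (1 + γ) * (2 * γ) ^ (-(γ / (1 + γ))) * (b / (1 - γ)) ^ (1 / (1 + γ))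

/-- `r` is a condensed local minimum: an interior local minimum of the scaling rate function. -/
def IsCondensedMin (γ b d r : ℝ) : Prop :=
  r ∈ Set.Ioo 0 d ∧ IsLocalMin (rateFun γ b d) r

end ZeroRange

end

/-!
The current is the canonical expectation of the jump rate, `j = E[g (η x)]` for every site `x`,
so `L * (j - 1)` is the expectation of `G = ∑ x, (g (η x) - 1)`. Put `a = L ^ (-α)` and
`T = L ^ (1 - 2 α)`, so that `L * a ^ 2 = T`. Jensen's inequality gives, for every real `t`,
`t * T * L ^ α * (j - 1) ≤ log (Z_t / Z)`, where `Z_t` is the partition function with the weights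
tilted by `exp (t * a * (g - 1))` (`exp_current_mul_partitionZ_le`). Hence bounds for partition
functions up to factors `exp (o (T))` determine the current up to `o (L ^ (-α))`, and no local
limit theorem is needed. With `I r = r ^ 2 / (2 σ²) + h (d - r)` and `h x = b / (1 - γ) x ^ (1 - γ)`
these bounds are as follows.

* `Z_t / z ^ L ≤ exp (- T * (min_r (I r - t r / σ²) - O(t²) - o(1)))`
  (`eventually_confSum_tilted_le`). Configurations are classified by the number `Y` of particles on
  sites with more than order `L ^ (1 - α)` particles. For each of the `N + 1` values of `Y` an
  exponential Markov bound is applied, with a linear tilt on small sites and the cost `(1 - ε) h` on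
  large ones. Subadditivity of `h` makes a single condensate optimal. The generating function on
  small sites is expanded to second order, using that `g` has mean `1` and covariance `1` with the
  occupation number under the critical distribution (`exists_mgf_bounds`).
* `Z / z ^ L ≥ exp (- T * (I r + o(1)))` for every `r` in `(0, d)` (`eventually_le_partitionZ`). One
  site takes whatever is left over by the others, and the others realise the excess density `r`
  within a window, by a change of tilt.

If `I` has a unique minimiser `r*` on `[0, d]`, the minimum of `I r - t r / σ²` is
`I r* - t r* / σ² + o(t)`; letting `t → 0` from both sides yields `L ^ α (j - 1) → r* / σ²`
(`tendsto_current`).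

The minimiser is found from `I (d - y) - I d = y * (y / (2 σ²) + b / (1 - γ) y ^ (-γ) - d / σ²)`
(`rateFunAux_sub`): the sum of the first two terms in the bracket has minimum `dTrans / σ²`,
attained at `y = transSize`. Below the transition `r* = d`. Above it `r*` is an interior critical point,
that is, `r* / σ² = b / (d - r*) ^ γ`, and strict concavity of `I'` leaves room for only one
interior local minimum (`exists_condensedMin`). As `d` decreases to `dTrans`, the condensate size `d - r*`
tends to `transSize > 0` (`condensate_size_bounds`), so the limiting current jumps down.
-/

namespace ZeroRange

variable {γ b : ℝ}

/-! ### Single-site weights -/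

/-- The cost `h x = b / (1 - γ) * x ^ (1 - γ)` of placing `x` particles on one site:
`weight n` is `exp (- h n)` up to factors that are negligible on the scale of the exponent. -/
noncomputable def jumpCost (γ b x : ℝ) : ℝ := b / (1 - γ) * x ^ (1 - γ)

lemma rate_succ (n : ℕ) : rate γ b (n + 1) = 1 + b / ((n : ℝ) + 1) ^ γ := by
  simp [rate]

lemma rate_zero : rate γ b 0 = 0 := by simp [rate]

lemma weight_zero : weight γ b 0 = 1 := by simp [weight]

lemma weight_succ (n : ℕ) : weight γ b (n + 1) = weight γ b n * (rate γ b (n + 1))⁻¹ := by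
  rw [weight, Finset.prod_Icc_succ_top (by omega)]; rfl

lemma rate_succ_pos (hb : 0 < b) (n : ℕ) : 0 < rate γ b (n + 1) := by
  rw [rate_succ]; positivity

lemma weight_pos (hb : 0 < b) (n : ℕ) : 0 < weight γ b n := by
  induction n with
  | zero => simp [weight_zero]
  | succ n ih => rw [weight_succ]; exact mul_pos ih (inv_pos.2 (rate_succ_pos hb n))

lemma rate_mul_weight_succ (hb : 0 < b) (n : ℕ) :
    rate γ b (n + 1) * weight γ b (n + 1) = weight γ b n := by
  rw [weight_succ]
  field_simp [(rate_succ_pos (γ := γ) hb n).ne']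

lemma abs_rate_sub_one_le (hγ0 : 0 < γ) (hb : 0 < b) (n : ℕ) : |rate γ b n - 1| ≤ 1 + b := by
  cases n with
  | zero => simp [rate_zero, hb.le]
  | succ n =>
    have h1 : (1 : ℝ) ≤ ((n : ℝ) + 1) ^ γ :=
      Real.one_le_rpow (by linarith [n.cast_nonneg (α := ℝ)]) hγ0.le
    have h2 : b / ((n : ℝ) + 1) ^ γ ≤ b := div_le_self hb.le h1
    have h3 : 0 ≤ b / ((n : ℝ) + 1) ^ γ := by positivity
    rw [rate_succ, abs_of_nonneg] <;> linarith

lemma jumpCost_nonneg (hγ1 : γ < 1) (hb : 0 < b) {x : ℝ} (hx : 0 ≤ x) : 0 ≤ jumpCost γ b x :=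
  mul_nonneg (div_nonneg hb.le (by linarith)) (Real.rpow_nonneg hx _)

lemma jumpCost_zero (hγ1 : γ < 1) : jumpCost γ b 0 = 0 := by
  rw [jumpCost, Real.zero_rpow (by linarith), mul_zero]

lemma jumpCost_mono (hγ1 : γ < 1) (hb : 0 < b) {x y : ℝ} (hx : 0 ≤ x) (hxy : x ≤ y) :
    jumpCost γ b x ≤ jumpCost γ b y :=
  mul_le_mul_of_nonneg_left (Real.rpow_le_rpow hx hxy (by linarith))
    (div_nonneg hb.le (by linarith))

lemma continuous_jumpCost (hγ1 : γ < 1) : Continuous (jumpCost γ b) := by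
  unfold jumpCost
  exact continuous_const.mul (Real.continuous_rpow_const (by linarith))

lemma jumpCost_mul {x y : ℝ} (hx : 0 ≤ x) (hy : 0 ≤ y) :
    jumpCost γ b (x * y) = x ^ (1 - γ) * jumpCost γ b y := by
  rw [jumpCost, jumpCost, Real.mul_rpow hx hy]; ring

lemma jumpCost_add_le (hγ0 : 0 < γ) (hγ1 : γ < 1) (hb : 0 < b) {x y : ℝ} (hx : 0 ≤ x)
    (hy : 0 ≤ y) : jumpCost γ b (x + y) ≤ jumpCost γ b x + jumpCost γ b y := by
  rw [jumpCost, jumpCost, jumpCost, ← mul_add]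
  exact mul_le_mul_of_nonneg_left (Real.rpow_add_le_add_rpow hx hy (by linarith) (by linarith))
    (div_nonneg hb.le (by linarith))

/-- The concave function `jumpCost` lies below its tangents. -/
lemma jumpCost_le_tangent (hγ0 : 0 < γ) (hγ1 : γ < 1) (hb : 0 < b) {x y : ℝ} (hx : 0 < x)
    (hy : 0 ≤ y) : jumpCost γ b y ≤ jumpCost γ b x + b / x ^ γ * (y - x) := by
  have h1 : (1 + (y / x - 1)) ^ (1 - γ) ≤ 1 + (1 - γ) * (y / x - 1) :=
    rpow_one_add_le_one_add_mul_self (by linarith [div_nonneg hy hx.le]) (by linarith)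
      (by linarith)
  have h2 : x ^ (1 - γ) = x / x ^ γ := by rw [Real.rpow_sub hx, Real.rpow_one]
  have h3 : jumpCost γ b y = x ^ (1 - γ) * (b / (1 - γ) * (1 + (y / x - 1)) ^ (1 - γ)) := by
    rw [show 1 + (y / x - 1) = y / x by ring, Real.div_rpow hy hx.le, jumpCost]
    have : x ^ (1 - γ) ≠ 0 := (Real.rpow_pos_of_pos hx _).ne'
    field_simp
  have h4 : (0 : ℝ) < 1 - γ := by linarith
  rw [h3]
  calc x ^ (1 - γ) * (b / (1 - γ) * (1 + (y / x - 1)) ^ (1 - γ))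
      ≤ x ^ (1 - γ) * (b / (1 - γ) * (1 + (1 - γ) * (y / x - 1))) := by gcongr
    _ = jumpCost γ b x + b / x ^ γ * (y - x) := by
      rw [jumpCost, h2]
      have : x ^ γ ≠ 0 := (Real.rpow_pos_of_pos hx _).ne'
      field_simp

lemma exp_neg_jumpCost_le_weight (hγ0 : 0 < γ) (hγ1 : γ < 1) (hb : 0 < b) (n : ℕ) :
    Real.exp (-jumpCost γ b n) ≤ weight γ b n := by
  induction n with
  | zero => simp [weight_zero, jumpCost_zero hγ1]
  | succ n ih =>
    have hpos : (0 : ℝ) < (n : ℝ) + 1 := by positivity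
    have h1 := jumpCost_le_tangent hγ0 hγ1 hb hpos (Nat.cast_nonneg n)
    have h2 : Real.exp (-(b / ((n : ℝ) + 1) ^ γ)) ≤ (rate γ b (n + 1))⁻¹ := by
      rw [Real.exp_neg]
      apply inv_anti₀ (rate_succ_pos hb n)
      rw [rate_succ, add_comm]
      exact Real.add_one_le_exp _
    rw [weight_succ]
    calc Real.exp (-jumpCost γ b ((n + 1 : ℕ) : ℝ))
        ≤ Real.exp (-jumpCost γ b n + -(b / ((n : ℝ) + 1) ^ γ)) := by
          apply Real.exp_le_exp.2
          push_cast
          linarith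
      _ = Real.exp (-jumpCost γ b n) * Real.exp (-(b / ((n : ℝ) + 1) ^ γ)) := Real.exp_add _ _
      _ ≤ _ := mul_le_mul ih h2 (Real.exp_nonneg _) (weight_pos hb n).le

lemma exp_mul_le_one_add {c x : ℝ} (hc0 : 0 ≤ c) (hc : c < 1) (hx0 : 0 ≤ x) (hx : x ≤ 1 - c) :
    Real.exp (c * x) ≤ 1 + x := by
  have hcx : |c * x| ≤ 1 := by
    rw [abs_of_nonneg (by positivity)]; nlinarith
  have := (abs_le.1 (Real.abs_exp_sub_one_sub_id_le hcx)).2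
  have h4 : c * x ≤ x := by nlinarith
  have h5 : c * (c * x) ≤ 1 - c := by nlinarith
  nlinarith

/-- The weights decay at least like `exp (- c h)` for every `c < 1`: the product
`weight n * exp (c * h (n + 1))` is eventually decreasing. -/
lemma exists_weight_mul_exp_le (hγ0 : 0 < γ) (hγ1 : γ < 1) (hb : 0 < b) {c : ℝ} (hc0 : 0 ≤ c)
    (hc : c < 1) : ∃ C : ℝ, 0 ≤ C ∧ ∀ n : ℕ, weight γ b n * Real.exp (c * jumpCost γ b n) ≤ C := by
  set v : ℕ → ℝ := fun n => weight γ b n * Real.exp (c * jumpCost γ b ((n : ℝ) + 1)) with hv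
  have hvpos : ∀ n, 0 ≤ v n := fun n => mul_nonneg (weight_pos hb n).le (Real.exp_nonneg _)
  have hlim : Tendsto (fun n : ℕ => b / ((n : ℝ) + 1) ^ γ) atTop (𝓝 0) :=
    Tendsto.div_atTop tendsto_const_nhds
      ((tendsto_rpow_atTop hγ0).comp
        (tendsto_atTop_add_const_right _ _ tendsto_natCast_atTop_atTop))
  obtain ⟨n0, hn0⟩ := eventually_atTop.1
    (hlim.eventually (Iio_mem_nhds (show (0 : ℝ) < 1 - c by linarith)))
  have hstep : ∀ n, n0 ≤ n → v (n + 1) ≤ v n := by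
    intro n hn
    have hx : b / ((n : ℝ) + 1) ^ γ < 1 - c := hn0 n hn
    have hx0 : 0 ≤ b / ((n : ℝ) + 1) ^ γ := by positivity
    set x := b / ((n : ℝ) + 1) ^ γ with hxdef
    have h1 := jumpCost_le_tangent hγ0 hγ1 hb (show (0 : ℝ) < (n : ℝ) + 1 by positivity)
      (show (0 : ℝ) ≤ (n : ℝ) + 1 + 1 by positivity)
    rw [← hxdef] at h1
    have h2 : Real.exp (c * x) ≤ 1 + x := exp_mul_le_one_add hc0 hc hx0 hx.le
    have hr : rate γ b (n + 1) = 1 + x := rate_succ n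
    have h3 : Real.exp (c * jumpCost γ b ((n : ℝ) + 1 + 1)) ≤
        Real.exp (c * jumpCost γ b ((n : ℝ) + 1)) * (1 + x) := by
      calc _ ≤ Real.exp (c * jumpCost γ b ((n : ℝ) + 1) + c * x) := by
            apply Real.exp_le_exp.2
            rw [← mul_add]
            apply mul_le_mul_of_nonneg_left _ hc0
            linarith
        _ = Real.exp (c * jumpCost γ b ((n : ℝ) + 1)) * Real.exp (c * x) := Real.exp_add _ _
        _ ≤ _ := mul_le_mul_of_nonneg_left h2 (Real.exp_nonneg _)
    have h6 : (0 : ℝ) < 1 + x := by linarith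
    simp only [hv]
    rw [weight_succ, hr]
    push_cast
    calc weight γ b n * (1 + x)⁻¹ * Real.exp (c * jumpCost γ b ((n : ℝ) + 1 + 1))
        ≤ weight γ b n * (1 + x)⁻¹ * (Real.exp (c * jumpCost γ b ((n : ℝ) + 1)) * (1 + x)) :=
          mul_le_mul_of_nonneg_left h3 (mul_nonneg (weight_pos hb n).le (inv_nonneg.2 h6.le))
      _ = _ := by field_simp
  refine ⟨∑ k ∈ Finset.range (n0 + 1), v k, Finset.sum_nonneg fun k _ => hvpos k, fun n => ?_⟩
  have hle : weight γ b n * Real.exp (c * jumpCost γ b n) ≤ v n := by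
    apply mul_le_mul_of_nonneg_left _ (weight_pos hb n).le
    apply Real.exp_le_exp.2 (mul_le_mul_of_nonneg_left _ hc0)
    exact jumpCost_mono hγ1 hb (Nat.cast_nonneg n) (by linarith)
  refine hle.trans ?_
  have hsing : ∀ k, k ≤ n0 → v k ≤ ∑ k ∈ Finset.range (n0 + 1), v k := fun k hk =>
    Finset.single_le_sum (fun i _ => hvpos i) (Finset.mem_range.2 (by omega))
  rcases le_total n n0 with h | h
  · exact hsing n h
  · induction n, h using Nat.le_induction with
    | base => exact hsing n0 le_rfl
    | succ m hm ih => exact (hstep m hm).trans (ih (by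
        apply mul_le_mul_of_nonneg_left _ (weight_pos hb m).le
        apply Real.exp_le_exp.2 (mul_le_mul_of_nonneg_left _ hc0)
        exact jumpCost_mono hγ1 hb (Nat.cast_nonneg m) (by linarith)))

/-- All stretched-exponential moments of order `c < 1` of the critical weights are finite. -/
lemma summable_pow_mul_weight_mul_exp (hγ0 : 0 < γ) (hγ1 : γ < 1) (hb : 0 < b) {c : ℝ}
    (hc0 : 0 ≤ c) (hc : c < 1) (p : ℕ) :
    Summable fun n : ℕ => (n : ℝ) ^ p * (weight γ b n * Real.exp (c * jumpCost γ b n)) := by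
  obtain ⟨C, hC0, hC⟩ := exists_weight_mul_exp_le hγ0 hγ1 hb (c := (1 + c) / 2) (by linarith)
    (by linarith)
  have h1γ : (0 : ℝ) < 1 - γ := by linarith
  set k : ℝ := (1 - c) / 2 * (b / (1 - γ)) with hk
  have hkpos : 0 < k := by
    apply mul_pos (by linarith) (by positivity)
  have hO : (fun n : ℕ => (n : ℝ) ^ p * Real.exp (-k * (n : ℝ) ^ (1 - γ)))
      =O[atTop] fun n : ℕ => (n : ℝ) ^ (-2 : ℝ) := by
    have h :=
      ((isLittleO_exp_neg_mul_rpow_atTop hkpos (-((p : ℝ) + 2) / (1 - γ))).isBigO.comp_tendsto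
      ((tendsto_rpow_atTop h1γ).comp tendsto_natCast_atTop_atTop))
    have h' := (isBigO_refl (fun n : ℕ => (n : ℝ) ^ p) atTop).mul h
    refine h'.congr' (Eventually.of_forall fun n => rfl) ?_
    filter_upwards [eventually_gt_atTop 0] with n hn
    have hn' : (0 : ℝ) < n := by exact_mod_cast hn
    simp only [Function.comp_apply]
    rw [← Real.rpow_mul hn'.le, ← Real.rpow_natCast, ← Real.rpow_add hn']
    congr 1
    field_simp
    ring
  have hS : Summable fun n : ℕ => C * ((n : ℝ) ^ p * Real.exp (-k * (n : ℝ) ^ (1 - γ))) :=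
    (summable_of_isBigO_nat (Real.summable_nat_rpow.2 (by norm_num)) hO).mul_left C
  refine Summable.of_nonneg_of_le (fun n => ?_) (fun n => ?_) hS
  · exact mul_nonneg (by positivity) (mul_nonneg (weight_pos hb n).le (Real.exp_nonneg _))
  · have e : Real.exp (c * jumpCost γ b n) = Real.exp ((1 + c) / 2 * jumpCost γ b n) *
        Real.exp (-k * (n : ℝ) ^ (1 - γ)) := by
      rw [← Real.exp_add]; congr 1; rw [hk, jumpCost]; ring
    rw [e]
    calc (n : ℝ) ^ p * (weight γ b n * (Real.exp ((1 + c) / 2 * jumpCost γ b n) *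
          Real.exp (-k * (n : ℝ) ^ (1 - γ))))
        = (weight γ b n * Real.exp ((1 + c) / 2 * jumpCost γ b n)) *
          ((n : ℝ) ^ p * Real.exp (-k * (n : ℝ) ^ (1 - γ))) := by ring
      _ ≤ _ := mul_le_mul_of_nonneg_right (hC n) (by positivity)

lemma summable_pow_mul_weight (hγ0 : 0 < γ) (hγ1 : γ < 1) (hb : 0 < b) (p : ℕ) :
    Summable fun n : ℕ => (n : ℝ) ^ p * weight γ b n := by
  simpa using summable_pow_mul_weight_mul_exp hγ0 hγ1 hb le_rfl one_pos p

/-! ### Moments of the critical distribution -/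

lemma hasSum_of_eq {f g : ℕ → ℝ} {x y : ℝ} (h : HasSum f x) (hf : ∀ n, g n = f n) (hx : y = x) :
    HasSum g y := by
  rw [hx, funext hf]; exact h

lemma hasSum_weight (hγ0 : 0 < γ) (hγ1 : γ < 1) (hb : 0 < b) :
    HasSum (weight γ b) (critZ γ b) := by
  have := summable_pow_mul_weight hγ0 hγ1 hb 0
  simp only [pow_zero, one_mul] at this
  exact this.hasSum

lemma critZ_pos (hγ0 : 0 < γ) (hγ1 : γ < 1) (hb : 0 < b) : 0 < critZ γ b := by
  have := le_hasSum (hasSum_weight hγ0 hγ1 hb) 0 fun n _ => (weight_pos hb n).le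
  rw [weight_zero] at this
  linarith

lemma hasSum_mul_weight (hγ0 : 0 < γ) (hγ1 : γ < 1) (hb : 0 < b) :
    HasSum (fun n : ℕ => (n : ℝ) * weight γ b n) (critZ γ b * rhoC γ b) := by
  have h := (summable_pow_mul_weight hγ0 hγ1 hb 1).hasSum
  simp only [pow_one] at h
  have hz := (critZ_pos hγ0 hγ1 hb).ne'
  have e : rhoC γ b = (∑' n : ℕ, (n : ℝ) * weight γ b n) / critZ γ b := by
    rw [rhoC, ← tsum_div_const]
    simp only [critProb, mul_div_assoc]
  rwa [e, mul_div_cancel₀ _ hz]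

lemma hasSum_sq_mul_weight (hγ0 : 0 < γ) (hγ1 : γ < 1) (hb : 0 < b) :
    HasSum (fun n : ℕ => (n : ℝ) ^ 2 * weight γ b n)
      (critZ γ b * (varC γ b + rhoC γ b ^ 2)) := by
  have h := (summable_pow_mul_weight hγ0 hγ1 hb 2).hasSum
  have hz := (critZ_pos hγ0 hγ1 hb).ne'
  have e : varC γ b + rhoC γ b ^ 2 = (∑' n : ℕ, (n : ℝ) ^ 2 * weight γ b n) / critZ γ b := by
    rw [varC, sub_add_cancel, ← tsum_div_const]
    simp only [critProb, mul_div_assoc]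
  rwa [e, mul_div_cancel₀ _ hz]

/-- At the critical fugacity `1` the mean jump rate is `1`. -/
lemma hasSum_rate_mul_weight (hγ0 : 0 < γ) (hγ1 : γ < 1) (hb : 0 < b) :
    HasSum (fun n : ℕ => rate γ b n * weight γ b n) (critZ γ b) := by
  have h := (hasSum_nat_add_iff (f := fun n : ℕ => rate γ b n * weight γ b n) 1
    (g := critZ γ b)).1
  simp only [rate_mul_weight_succ hb, Finset.range_one, Finset.sum_singleton, rate_zero, zero_mul,
    add_zero] at h
  exact h (hasSum_weight hγ0 hγ1 hb)

lemma hasSum_mul_rate_mul_weight (hγ0 : 0 < γ) (hγ1 : γ < 1) (hb : 0 < b) :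
    HasSum (fun n : ℕ => (n : ℝ) * (rate γ b n * weight γ b n))
      (critZ γ b * (rhoC γ b + 1)) := by
  have h := (hasSum_nat_add_iff (f := fun n : ℕ => (n : ℝ) * (rate γ b n * weight γ b n)) 1
    (g := critZ γ b * (rhoC γ b + 1))).1
  simp only [rate_mul_weight_succ hb, Finset.range_one, Finset.sum_singleton, Nat.cast_zero,
    zero_mul, add_zero] at h
  apply h
  have := (hasSum_mul_weight hγ0 hγ1 hb).add (hasSum_weight hγ0 hγ1 hb)
  exact hasSum_of_eq this (fun n => by push_cast; ring) (by ring)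

/-- The variance of the jump rate under the critical single-site distribution. -/
noncomputable def rateVar (γ b : ℝ) : ℝ :=
  (∑' n : ℕ, (rate γ b n - 1) ^ 2 * weight γ b n) / critZ γ b

lemma hasSum_rate_sub_one_sq_mul_weight (hγ0 : 0 < γ) (hγ1 : γ < 1) (hb : 0 < b) :
    HasSum (fun n : ℕ => (rate γ b n - 1) ^ 2 * weight γ b n)
      (critZ γ b * rateVar γ b) := by
  have hS : Summable fun n : ℕ => (rate γ b n - 1) ^ 2 * weight γ b n := by
    refine Summable.of_nonneg_of_le
      (fun n => mul_nonneg (sq_nonneg _) (weight_pos hb n).le) (fun n => ?_)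
      ((hasSum_weight hγ0 hγ1 hb).summable.mul_left ((1 + b) ^ 2))
    apply mul_le_mul_of_nonneg_right _ (weight_pos hb n).le
    exact sq_le_sq' (neg_le_of_abs_le (abs_rate_sub_one_le hγ0 hb n))
      (le_of_abs_le (abs_rate_sub_one_le hγ0 hb n))
  rw [rateVar, mul_div_cancel₀ _ (critZ_pos hγ0 hγ1 hb).ne']
  exact hS.hasSum

lemma hasSum_sub_rhoC_sq (hγ0 : 0 < γ) (hγ1 : γ < 1) (hb : 0 < b) :
    HasSum (fun n : ℕ => ((n : ℝ) - rhoC γ b) ^ 2 * weight γ b n) (critZ γ b * varC γ b) := by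
  have := ((hasSum_sq_mul_weight hγ0 hγ1 hb).sub
    ((hasSum_mul_weight hγ0 hγ1 hb).mul_left (2 * rhoC γ b))).add
    ((hasSum_weight hγ0 hγ1 hb).mul_left (rhoC γ b ^ 2))
  exact hasSum_of_eq this (fun n => by ring) (by ring)

lemma rhoC_pos (hγ0 : 0 < γ) (hγ1 : γ < 1) (hb : 0 < b) : 0 < rhoC γ b := by
  have := le_hasSum (hasSum_mul_weight hγ0 hγ1 hb) 1
    fun n _ => mul_nonneg n.cast_nonneg (weight_pos hb n).le
  have h1 := weight_pos (γ := γ) hb 1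
  push_cast at this
  exact pos_of_mul_pos_right (by linarith) (critZ_pos hγ0 hγ1 hb).le

lemma varC_pos (hγ0 : 0 < γ) (hγ1 : γ < 1) (hb : 0 < b) : 0 < varC γ b := by
  have := le_hasSum (hasSum_sub_rhoC_sq hγ0 hγ1 hb) 0
    fun n _ => mul_nonneg (sq_nonneg _) (weight_pos hb n).le
  have h1 := rhoC_pos hγ0 hγ1 hb
  rw [weight_zero] at this
  push_cast at this
  exact pos_of_mul_pos_right (by nlinarith) (critZ_pos hγ0 hγ1 hb).le

/-- The second-order expansion of a moment generating function, for the two centred observables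
`n - ρ_c` and `g n - 1`. Their covariance is `1`. -/
lemma hasSum_weight_mul_quadratic (hγ0 : 0 < γ) (hγ1 : γ < 1) (hb : 0 < b) (a θ t : ℝ) :
    HasSum (fun n : ℕ => weight γ b n *
        (1 + a * (θ * ((n : ℝ) - rhoC γ b) + t * (rate γ b n - 1))
          + (a * (θ * ((n : ℝ) - rhoC γ b) + t * (rate γ b n - 1))) ^ 2 / 2))
      (critZ γ b * (1 + a ^ 2 / 2 *
        (θ ^ 2 * varC γ b + 2 * θ * t + t ^ 2 * rateVar γ b))) := by
  have H0 := hasSum_weight hγ0 hγ1 hb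
  have H1 := hasSum_mul_weight hγ0 hγ1 hb
  have Hg := hasSum_rate_mul_weight hγ0 hγ1 hb
  have Hng := hasSum_mul_rate_mul_weight hγ0 hγ1 hb
  have Hgg := hasSum_rate_sub_one_sq_mul_weight hγ0 hγ1 hb
  have H2 := hasSum_sub_rhoC_sq hγ0 hγ1 hb
  have c1 := H1.sub (H0.mul_left (rhoC γ b))
  have cg := Hg.sub H0
  have c11 := ((Hng.sub H1).sub (Hg.mul_left (rhoC γ b))).add (H0.mul_left (rhoC γ b))
  have := ((((H0.add (c1.mul_left (a * θ))).add (cg.mul_left (a * t))).add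
    (H2.mul_left (a ^ 2 / 2 * θ ^ 2))).add (c11.mul_left (a ^ 2 * θ * t))).add
    (Hgg.mul_left (a ^ 2 / 2 * t ^ 2))
  exact hasSum_of_eq this (fun n => by ring) (by ring)

/-! ### Truncated moment generating functions -/

lemma abs_exp_sub_quadratic_le (u : ℝ) :
    |Real.exp u - (1 + u + u ^ 2 / 2)| ≤ |u| ^ 3 * Real.exp |u| := by
  have h := Complex.norm_exp_sub_sum_le_norm_mul_exp (u : ℂ) 3
  have e : Complex.exp (u : ℂ) - ∑ m ∈ Finset.range 3, (u : ℂ) ^ m / (m.factorial : ℂ)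
      = ((Real.exp u - (1 + u + u ^ 2 / 2) : ℝ) : ℂ) := by
    simp [Finset.sum_range_succ, Nat.factorial]
  rw [e, Complex.norm_real, Complex.norm_real, Real.norm_eq_abs, Real.norm_eq_abs] at h
  exact h

lemma natCast_rpow_le_self (hγ0 : 0 < γ) (hγ1 : γ < 1) (n : ℕ) : (n : ℝ) ^ γ ≤ n := by
  rcases Nat.eq_zero_or_pos n with rfl | hn
  · simp [Real.zero_rpow hγ0.ne']
  · calc (n : ℝ) ^ γ ≤ (n : ℝ) ^ (1 : ℝ) :=
        Real.rpow_le_rpow_of_exponent_le (by exact_mod_cast hn) hγ1.le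
      _ = n := Real.rpow_one _

lemma one_le_cube_of_lt (hγ0 : 0 < γ) (hγ1 : γ < 1) {δ a : ℝ} (hδ : 0 < δ) (ha : 0 < a) {n : ℕ}
    (hn : δ < a * (n : ℝ) ^ γ) : 1 ≤ a ^ 3 * ((n : ℝ) ^ 3 / δ ^ 3) := by
  have h : δ ≤ a * n :=
    hn.le.trans (mul_le_mul_of_nonneg_left (natCast_rpow_le_self hγ0 hγ1 n) ha.le)
  have h1 : 1 ≤ a * n / δ := by rwa [le_div_iff₀ hδ, one_mul]
  calc (1 : ℝ) ≤ (a * n / δ) ^ 3 := one_le_pow₀ h1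
    _ = _ := by ring

lemma summable_add_pow_mul_weight_mul_exp (hγ0 : 0 < γ) (hγ1 : γ < 1) (hb : 0 < b) {c : ℝ}
    (hc0 : 0 ≤ c) (hc : c < 1) (p : ℕ) {q : ℝ} (hq : 0 ≤ q) :
    Summable fun n : ℕ => ((n : ℝ) + q) ^ p * (weight γ b n * Real.exp (c * jumpCost γ b n)) := by
  have hnn : ∀ n : ℕ, 0 ≤ weight γ b n * Real.exp (c * jumpCost γ b n) := fun n =>
    mul_nonneg (weight_pos hb n).le (Real.exp_nonneg _)
  have h1 := summable_pow_mul_weight_mul_exp hγ0 hγ1 hb hc0 hc p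
  have h2 := (summable_pow_mul_weight_mul_exp hγ0 hγ1 hb hc0 hc 0).mul_left (q ^ p)
  refine Summable.of_nonneg_of_le (fun n => mul_nonneg (by positivity) (hnn n)) (fun n => ?_)
    ((h1.add h2).mul_left (2 ^ (p - 1)))
  calc ((n : ℝ) + q) ^ p * (weight γ b n * Real.exp (c * jumpCost γ b n))
      ≤ 2 ^ (p - 1) * ((n : ℝ) ^ p + q ^ p) * (weight γ b n * Real.exp (c * jumpCost γ b n)) :=
        mul_le_mul_of_nonneg_right (add_pow_le n.cast_nonneg hq p) (hnn n)
    _ = _ := by ring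

/-- Sites holding more than `(δ / a) ^ (1 / γ)` particles contribute a negligible amount, even
after tilting by almost the full jump cost. -/
lemma exists_sum_large_le (hγ0 : 0 < γ) (hγ1 : γ < 1) (hb : 0 < b) {c : ℝ} (hc0 : 0 ≤ c)
    (hc : c < 1) {δ : ℝ} (hδ : 0 < δ) : ∃ C : ℝ, 0 ≤ C ∧ ∀ a : ℝ, 0 < a → ∀ s : Finset ℕ,
      (∀ n ∈ s, δ < a * (n : ℝ) ^ γ) →
      ∑ n ∈ s, weight γ b n * Real.exp (c * jumpCost γ b n) ≤ C * a ^ 3 := by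
  have hS := summable_pow_mul_weight_mul_exp hγ0 hγ1 hb hc0 hc 3
  have hnn : ∀ n : ℕ, 0 ≤ weight γ b n * Real.exp (c * jumpCost γ b n) := fun n =>
    mul_nonneg (weight_pos hb n).le (Real.exp_nonneg _)
  have hnn3 : ∀ n : ℕ, 0 ≤ (n : ℝ) ^ 3 * (weight γ b n * Real.exp (c * jumpCost γ b n)) :=
    fun n => mul_nonneg (by positivity) (hnn n)
  refine ⟨(∑' n : ℕ, (n : ℝ) ^ 3 * (weight γ b n * Real.exp (c * jumpCost γ b n))) / δ ^ 3,
    div_nonneg (tsum_nonneg hnn3) (by positivity), fun a ha s hs => ?_⟩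
  calc ∑ n ∈ s, weight γ b n * Real.exp (c * jumpCost γ b n)
      ≤ ∑ n ∈ s, a ^ 3 / δ ^ 3 *
          ((n : ℝ) ^ 3 * (weight γ b n * Real.exp (c * jumpCost γ b n))) := by
        refine Finset.sum_le_sum fun n hn => ?_
        have h1 := one_le_cube_of_lt hγ0 hγ1 hδ ha (hs n hn)
        calc _ ≤ (a ^ 3 * ((n : ℝ) ^ 3 / δ ^ 3)) *
              (weight γ b n * Real.exp (c * jumpCost γ b n)) :=
              le_mul_of_one_le_left (hnn n) h1
          _ = _ := by ring
    _ = a ^ 3 / δ ^ 3 * ∑ n ∈ s, (n : ℝ) ^ 3 * (weight γ b n * Real.exp (c * jumpCost γ b n)) := by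
        rw [Finset.mul_sum]
    _ ≤ a ^ 3 / δ ^ 3 * ∑' n : ℕ, (n : ℝ) ^ 3 * (weight γ b n * Real.exp (c * jumpCost γ b n)) := by
        apply mul_le_mul_of_nonneg_left _ (by positivity)
        exact hS.sum_le_tsum s fun n _ => hnn3 n
    _ = _ := by ring

/-- Two-sided second-order expansion of the moment generating function truncated at
`n ≤ (δ / a) ^ (1 / γ)`, uniformly over tilts of size at most `K * a`. On this range the linear
tilt is at most a quarter of the jump cost, so that all error terms are summable. -/
lemma exists_mgf_bounds (hγ0 : 0 < γ) (hγ1 : γ < 1) (hb : 0 < b) {K : ℝ} (hK : 0 < K) :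
    ∃ δ : ℝ, 0 < δ ∧ ∃ C : ℝ, 0 ≤ C ∧ ∀ a θ t : ℝ, 0 < a → a ≤ 1 → |θ| ≤ K → |t| ≤ K →
      ∀ s : Finset ℕ, (∀ n : ℕ, n ∈ s → a * (n : ℝ) ^ γ ≤ δ) →
      (∑ n ∈ s, weight γ b n *
          Real.exp (a * (θ * ((n : ℝ) - rhoC γ b) + t * (rate γ b n - 1)))
        ≤ critZ γ b * (1 + a ^ 2 / 2 * (θ ^ 2 * varC γ b + 2 * θ * t + t ^ 2 * rateVar γ b))
          + C * a ^ 3) ∧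
      ((∀ n : ℕ, a * (n : ℝ) ^ γ ≤ δ → n ∈ s) →
        critZ γ b * (1 + a ^ 2 / 2 * (θ ^ 2 * varC γ b + 2 * θ * t + t ^ 2 * rateVar γ b))
          - C * a ^ 3 ≤ ∑ n ∈ s, weight γ b n *
          Real.exp (a * (θ * ((n : ℝ) - rhoC γ b) + t * (rate γ b n - 1)))) := by
  have h1γ : (0 : ℝ) < 1 - γ := by linarith
  have hρ := rhoC_pos hγ0 hγ1 hb
  set ρ := rhoC γ b with hρdef
  set q : ℝ := ρ + 1 + b with hq
  have hqpos : 0 < q := by positivity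
  -- since `n = n ^ γ * n ^ (1 - γ)`, this makes `a * K * n ≤ h n / 4` whenever `a * n ^ γ ≤ δ`
  set δ : ℝ := b / (1 - γ) / 4 / K with hδ
  have hδpos : 0 < δ := by positivity
  have hKδ : K * δ = b / (1 - γ) / 4 := by rw [hδ]; field_simp
  -- `E1` bounds the Taylor remainder on small sites, `E2` the quadratic term on large sites
  set E1 : ℕ → ℝ := fun n => K ^ 3 * Real.exp (K * q) *
    (((n : ℝ) + q) ^ 3 * (weight γ b n * Real.exp (1 / 4 * jumpCost γ b n))) with hE1
  set E2 : ℕ → ℝ := fun n => (1 + K) ^ 2 / δ ^ 3 *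
    (((n : ℝ) + q) ^ 5 * (weight γ b n * Real.exp (0 * jumpCost γ b n))) with hE2
  have hS1 : Summable E1 := (summable_add_pow_mul_weight_mul_exp hγ0 hγ1 hb (by norm_num)
    (by norm_num) 3 hqpos.le).mul_left _
  have hS2 : Summable E2 := (summable_add_pow_mul_weight_mul_exp hγ0 hγ1 hb le_rfl
    (by norm_num) 5 hqpos.le).mul_left _
  have hw : ∀ n, 0 < weight γ b n := weight_pos hb
  have hE1nn : ∀ n, 0 ≤ E1 n := fun n => mul_nonneg (by positivity) (mul_nonneg (by positivity)
    (mul_nonneg (hw n).le (Real.exp_nonneg _)))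
  have hE2nn : ∀ n, 0 ≤ E2 n := fun n => mul_nonneg (by positivity) (mul_nonneg (by positivity)
    (mul_nonneg (hw n).le (Real.exp_nonneg _)))
  refine ⟨δ, hδpos, ∑' n, (E1 n + E2 n), tsum_nonneg fun n => add_nonneg (hE1nn n) (hE2nn n), ?_⟩
  intro a θ t ha ha1 hθ ht s hs
  have HQ := hasSum_weight_mul_quadratic hγ0 hγ1 hb a θ t
  rw [← hρdef] at HQ
  set Q := critZ γ b * (1 + a ^ 2 / 2 * (θ ^ 2 * varC γ b + 2 * θ * t + t ^ 2 * rateVar γ b))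
  set u : ℕ → ℝ := fun n => a * (θ * ((n : ℝ) - ρ) + t * (rate γ b n - 1)) with hu
  have hu_le : ∀ n, |u n| ≤ a * (K * ((n : ℝ) + q)) := by
    intro n
    have h1 : |(n : ℝ) - ρ| ≤ n + ρ := by
      rw [abs_le]; constructor <;> linarith [n.cast_nonneg (α := ℝ)]
    have h2 : |rate γ b n - 1| ≤ 1 + b := abs_rate_sub_one_le hγ0 hb n
    rw [hu]
    simp only
    rw [abs_mul, abs_of_pos ha]
    apply mul_le_mul_of_nonneg_left _ ha.le
    calc |θ * ((n : ℝ) - ρ) + t * (rate γ b n - 1)|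
        ≤ |θ| * |(n : ℝ) - ρ| + |t| * |rate γ b n - 1| := by
          rw [← abs_mul, ← abs_mul]; exact abs_add_le _ _
      _ ≤ K * (n + ρ) + K * (1 + b) := by gcongr
      _ = _ := by rw [hq]; ring
  have herr : ∀ n : ℕ, a * (n : ℝ) ^ γ ≤ δ →
      weight γ b n * |Real.exp (u n) - (1 + u n + (u n) ^ 2 / 2)| ≤ a ^ 3 * E1 n := by
    intro n hn
    have h1 : a * (K * (n : ℝ)) ≤ 1 / 4 * jumpCost γ b n := by
      have e : (n : ℝ) = (n : ℝ) ^ γ * (n : ℝ) ^ (1 - γ) := by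
        rcases Nat.eq_zero_or_pos n with rfl | hn
        · simp [Real.zero_rpow hγ0.ne']
        · rw [← Real.rpow_add (by exact_mod_cast hn)]; simp
      calc a * (K * (n : ℝ)) = K * (a * (n : ℝ) ^ γ) * (n : ℝ) ^ (1 - γ) := by
            conv_lhs => rw [e]
            ring
        _ ≤ K * δ * (n : ℝ) ^ (1 - γ) := by gcongr
        _ = _ := by rw [hKδ, jumpCost]; ring
    have h2 : |u n| ≤ K * q + 1 / 4 * jumpCost γ b n := by
      calc |u n| ≤ a * (K * ((n : ℝ) + q)) := hu_le n
        _ = a * (K * q) + a * (K * n) := by ring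
        _ ≤ 1 * (K * q) + 1 / 4 * jumpCost γ b n := by gcongr
        _ = _ := by ring
    calc weight γ b n * |Real.exp (u n) - (1 + u n + (u n) ^ 2 / 2)|
        ≤ weight γ b n * (|u n| ^ 3 * Real.exp |u n|) :=
          mul_le_mul_of_nonneg_left (abs_exp_sub_quadratic_le _) (hw n).le
      _ ≤ weight γ b n * ((a * (K * ((n : ℝ) + q))) ^ 3 *
            Real.exp (K * q + 1 / 4 * jumpCost γ b n)) := by
          apply mul_le_mul_of_nonneg_left _ (hw n).le
          gcongr
          exact hu_le n
      _ = a ^ 3 * E1 n := by rw [hE1, Real.exp_add]; ring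
  have hquad_nn : ∀ n, 0 ≤ 1 + u n + (u n) ^ 2 / 2 := fun n => by nlinarith [sq_nonneg (1 + u n)]
  have hlarge : ∀ n : ℕ, δ < a * (n : ℝ) ^ γ →
      weight γ b n * (1 + u n + (u n) ^ 2 / 2) ≤ a ^ 3 * E2 n := by
    intro n hn
    have h1 : |u n| ≤ K * ((n : ℝ) + q) := (hu_le n).trans (by
      have : 0 ≤ K * ((n : ℝ) + q) := by positivity
      nlinarith)
    have h2 : 1 + u n + (u n) ^ 2 / 2 ≤ ((1 + K) * ((n : ℝ) + q)) ^ 2 := by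
      have hq1 : 1 ≤ (n : ℝ) + q := by rw [hq]; linarith [n.cast_nonneg (α := ℝ)]
      have h3 : 1 + |u n| ≤ (1 + K) * ((n : ℝ) + q) := by nlinarith
      calc 1 + u n + (u n) ^ 2 / 2 ≤ (1 + |u n|) ^ 2 := by
            nlinarith [le_abs_self (u n), sq_abs (u n), abs_nonneg (u n)]
        _ ≤ _ := by gcongr
    have h4 := one_le_cube_of_lt hγ0 hγ1 hδpos ha hn
    calc weight γ b n * (1 + u n + (u n) ^ 2 / 2)
        ≤ weight γ b n * (((1 + K) * ((n : ℝ) + q)) ^ 2 * 1) := by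
          rw [mul_one]; exact mul_le_mul_of_nonneg_left h2 (hw n).le
      _ ≤ weight γ b n *
            (((1 + K) * ((n : ℝ) + q)) ^ 2 * (a ^ 3 * (((n : ℝ) + q) ^ 3 / δ ^ 3))) := by
          apply mul_le_mul_of_nonneg_left _ (hw n).le
          apply mul_le_mul_of_nonneg_left _ (by positivity)
          refine h4.trans ?_
          gcongr
          linarith
      _ = a ^ 3 * E2 n := by simp only [hE2, zero_mul, Real.exp_zero]; ring
  have hSE : Summable fun n => E1 n + E2 n := hS1.add hS2
  constructor
  · have : ∀ n ∈ s, weight γ b n * Real.exp (u n) ≤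
        weight γ b n * (1 + u n + (u n) ^ 2 / 2) + a ^ 3 * (E1 n + E2 n) := by
      intro n hn
      have h1 := herr n (hs n hn)
      have h2 := mul_le_mul_of_nonneg_left
        (le_abs_self (Real.exp (u n) - (1 + u n + (u n) ^ 2 / 2))) (hw n).le
      have h3 : 0 ≤ a ^ 3 * E2 n := mul_nonneg (by positivity) (hE2nn n)
      linarith
    refine (Finset.sum_le_sum this).trans ?_
    have HT := HQ.add (hSE.hasSum.mul_left (a ^ 3))
    refine (sum_le_hasSum s (fun n _ => ?_) HT).trans (by rw [mul_comm (a ^ 3)])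
    exact add_nonneg (mul_nonneg (hw n).le (hquad_nn n))
      (mul_nonneg (by positivity) (add_nonneg (hE1nn n) (hE2nn n)))
  · intro hs'
    have hfin : HasSum (fun n => if n ∈ s then weight γ b n * Real.exp (u n) else 0)
        (∑ n ∈ s, if n ∈ s then weight γ b n * Real.exp (u n) else 0) :=
      hasSum_sum_of_ne_finset_zero fun n hn => by simp [hn]
    have HT := hfin.add (hSE.hasSum.mul_left (a ^ 3))
    have hle := hasSum_le (fun n => ?_) HQ HT
    · rw [Finset.sum_congr rfl (fun n hn => if_pos hn)] at hle
      rw [sub_le_iff_le_add, mul_comm _ (a ^ 3)]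
      exact hle
    · change weight γ b n * (1 + u n + (u n) ^ 2 / 2) ≤ _
      by_cases hn : n ∈ s
      · have h1 := herr n (hs n hn)
        have h2 := mul_le_mul_of_nonneg_left
          (neg_abs_le (Real.exp (u n) - (1 + u n + (u n) ^ 2 / 2))) (hw n).le
        have h3 : 0 ≤ a ^ 3 * E2 n := mul_nonneg (by positivity) (hE2nn n)
        simp only [hn, if_true]
        linarith
      · have h1 := hlarge n (lt_of_not_ge fun h => hn (hs' n h))
        have h3 : 0 ≤ a ^ 3 * E1 n := mul_nonneg (by positivity) (hE1nn n)
        simp only [hn, if_false]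
        linarith

/-! ### Partition functions of general and tilted weights -/

/-- The partition function of `N` particles on `L` sites for an arbitrary single-site weight. -/
def confSum (v : ℕ → ℝ) (L N : ℕ) : ℝ :=
  ∑ η ∈ Finset.piAntidiag (Finset.univ : Finset (Fin L)) N, ∏ x, v (η x)

/-- The weights tilted by the centred jump rate: `w n * exp (τ * (g n - 1))`. -/
noncomputable def tiltedWeight (γ b τ : ℝ) (n : ℕ) : ℝ :=
  weight γ b n * Real.exp (τ * (rate γ b n - 1))

lemma mem_piAntidiag_univ {L N : ℕ} {η : Fin L → ℕ} :
    η ∈ Finset.piAntidiag (Finset.univ : Finset (Fin L)) N ↔ ∑ x, η x = N := by simp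

lemma partitionZ_eq_confSum (L N : ℕ) : partitionZ γ b L N = confSum (weight γ b) L N := rfl

/-- The canonical expectation of the jump rate at any site is the current, in the form of an
identity between partition functions. -/
lemma sum_prod_weight_mul_rate (hb : 0 < b) {L N : ℕ} (hN : 1 ≤ N) (x₀ : Fin L) :
    ∑ η ∈ Finset.piAntidiag (Finset.univ : Finset (Fin L)) N,
      (∏ x, weight γ b (η x)) * rate γ b (η x₀) = partitionZ γ b L (N - 1) := by
  symm
  refine Finset.sum_of_injOn (fun ξ => Function.update ξ x₀ (ξ x₀ + 1)) ?_ ?_ ?_ ?_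
  · intro ξ _ ζ _ h
    funext x
    have hx := congrFun h x
    by_cases hxx : x = x₀
    · subst hxx; simpa using hx
    · simpa [Function.update_of_ne hxx] using hx
  · intro ξ hξ
    rw [Finset.mem_coe, mem_piAntidiag_univ] at hξ ⊢
    rw [Finset.sum_update_of_mem (Finset.mem_univ x₀)]
    rw [← Finset.add_sum_erase _ _ (Finset.mem_univ x₀)] at hξ
    rw [Finset.sdiff_singleton_eq_erase]
    omega
  · intro η hη hη'
    rw [mem_piAntidiag_univ] at hη
    have h0 : η x₀ = 0 := by
      by_contra hne
      apply hη'
      refine ⟨Function.update η x₀ (η x₀ - 1), ?_, ?_⟩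
      · rw [Finset.mem_coe, mem_piAntidiag_univ, Finset.sum_update_of_mem (Finset.mem_univ x₀),
          Finset.sdiff_singleton_eq_erase]
        rw [← Finset.add_sum_erase _ _ (Finset.mem_univ x₀)] at hη
        omega
      · simp only [Function.update_self, Function.update_idem]
        rw [Nat.sub_add_cancel (Nat.one_le_iff_ne_zero.2 hne), Function.update_eq_self]
    rw [h0, rate_zero, mul_zero]
  · intro ξ _
    rw [← Finset.mul_prod_erase _ _ (Finset.mem_univ x₀),
      ← Finset.mul_prod_erase _ (fun x => weight γ b (Function.update ξ x₀ (ξ x₀ + 1) x))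
        (Finset.mem_univ x₀)]
    rw [Function.update_self, ← rate_mul_weight_succ hb (ξ x₀)]
    have : ∏ x ∈ Finset.univ.erase x₀, weight γ b (Function.update ξ x₀ (ξ x₀ + 1) x)
        = ∏ x ∈ Finset.univ.erase x₀, weight γ b (ξ x) :=
      Finset.prod_congr rfl fun x hx => by rw [Function.update_of_ne (Finset.ne_of_mem_erase hx)]
    rw [this]
    ring

/-- Jensen's inequality for the canonical measure and the observable `∑ x, (g (η x) - 1)`, whose
mean is `L * (j - 1)`. -/
lemma exp_current_mul_partitionZ_le (hb : 0 < b) {L N : ℕ} (hN : 1 ≤ N)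
    (hZ : 0 < partitionZ γ b L N) (τ : ℝ) :
    Real.exp (τ * (L * (current γ b L N - 1))) * partitionZ γ b L N
      ≤ confSum (tiltedWeight γ b τ) L N := by
  set m := τ * (L * (current γ b L N - 1)) with hm
  have hpt : ∀ η : Fin L → ℕ, Real.exp m * ((∏ x, weight γ b (η x)) * (1 - m)
      + τ * ∑ x₀, ((∏ x, weight γ b (η x)) * rate γ b (η x₀) - ∏ x, weight γ b (η x)))
      ≤ ∏ x, tiltedWeight γ b τ (η x) := by
    intro η
    have hP : 0 ≤ ∏ x, weight γ b (η x) := Finset.prod_nonneg fun x _ => (weight_pos hb _).le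
    have e1 : ∏ x, tiltedWeight γ b τ (η x)
        = (∏ x, weight γ b (η x)) * Real.exp (τ * ∑ x, (rate γ b (η x) - 1)) := by
      simp only [tiltedWeight]
      rw [Finset.prod_mul_distrib, ← Real.exp_sum, Finset.mul_sum]
    set S := ∑ x, (rate γ b (η x) - 1) with hS
    have e2 : ∑ x₀, ((∏ x, weight γ b (η x)) * rate γ b (η x₀) - ∏ x, weight γ b (η x))
        = (∏ x, weight γ b (η x)) * S := by
      rw [hS, Finset.mul_sum]
      exact Finset.sum_congr rfl fun x _ => by ring
    have e3 : Real.exp (τ * S) = Real.exp m * Real.exp (τ * S - m) := by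
      rw [← Real.exp_add]; ring_nf
    have h4 := Real.add_one_le_exp (τ * S - m)
    rw [e1, e2, e3]
    calc _ = (∏ x, weight γ b (η x)) * (Real.exp m * (τ * S - m + 1)) := by ring
      _ ≤ _ := by gcongr
  have hsum := Finset.sum_le_sum fun η (_ : η ∈ Finset.piAntidiag
    (Finset.univ : Finset (Fin L)) N) => hpt η
  have hcur : current γ b L N * partitionZ γ b L N = partitionZ γ b L (N - 1) := by
    rw [current]; field_simp
  have e : ∑ η ∈ Finset.piAntidiag (Finset.univ : Finset (Fin L)) N,
      Real.exp m * ((∏ x, weight γ b (η x)) * (1 - m)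
      + τ * ∑ x₀, ((∏ x, weight γ b (η x)) * rate γ b (η x₀) - ∏ x, weight γ b (η x)))
      = Real.exp m * partitionZ γ b L N := by
    rw [← Finset.mul_sum, Finset.sum_add_distrib, ← Finset.sum_mul, ← Finset.mul_sum,
      Finset.sum_comm]
    simp only [Finset.sum_sub_distrib, sum_prod_weight_mul_rate hb hN]
    rw [Finset.sum_const, Finset.sum_const, Finset.card_univ, Fintype.card_fin]
    change Real.exp m * (partitionZ γ b L N * (1 - m) +
      τ * (L • partitionZ γ b L (N - 1) - L • partitionZ γ b L N)) = _
    rw [← hcur, nsmul_eq_mul, nsmul_eq_mul, hm]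
    ring
  rw [e] at hsum
  exact hsum

lemma confSum_le_pow {v : ℕ → ℝ} (hv : ∀ n, 0 ≤ v n) (L N : ℕ) :
    confSum v L N ≤ (∑ n ∈ Finset.range (N + 1), v n) ^ L := by
  have e : (∑ n ∈ Finset.range (N + 1), v n) ^ L
      = ∑ η ∈ Fintype.piFinset fun _ : Fin L => Finset.range (N + 1), ∏ x, v (η x) := by
    rw [← Finset.prod_univ_sum]
    simp
  rw [e]
  refine Finset.sum_le_sum_of_subset_of_nonneg (fun η hη => ?_)
    fun η _ _ => Finset.prod_nonneg fun _ _ => hv _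
  rw [mem_piAntidiag_univ] at hη
  rw [Fintype.mem_piFinset]
  intro x
  have := Finset.single_le_sum (f := η) (fun _ _ => Nat.zero_le _) (Finset.mem_univ x)
  rw [Finset.mem_range]
  omega

/-- An exponential Markov bound in which the configurations are classified by the number `Y` of
particles on large sites. Small sites are tilted linearly, with a slope that may depend on `Y`,
and large sites by a subadditive cost `φ`. -/
lemma confSum_le_sum_large {v φ : ℕ → ℝ} (hv : ∀ n, 0 ≤ v n) (hφ0 : φ 0 = 0)
    (hφ : ∀ m n, φ (m + n) ≤ φ m + φ n) (small : ℕ → Prop) [DecidablePred small] {ρ : ℝ}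
    (hρ : 0 ≤ ρ) {θ : ℕ → ℝ} (hθ : ∀ Y, 0 ≤ θ Y) (L N : ℕ) :
    confSum v L N ≤ ∑ Y ∈ Finset.range (N + 1),
      (∑ n ∈ Finset.range (N + 1),
        v n * (if small n then Real.exp (θ Y * ((n : ℝ) - ρ)) else Real.exp (φ n))) ^ L
      * Real.exp (-(θ Y * ((N : ℝ) - Y - ρ * L) + φ Y)) := by
  set F : ℕ → ℕ → ℝ := fun Y n =>
    v n * (if small n then Real.exp (θ Y * ((n : ℝ) - ρ)) else Real.exp (φ n)) with hF
  have hFnn : ∀ Y n, 0 ≤ F Y n := fun Y n => mul_nonneg (hv n) (by split_ifs <;> positivity)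
  have hpt : ∀ η ∈ Finset.piAntidiag (Finset.univ : Finset (Fin L)) N,
      ∏ x, v (η x) ≤ ∑ Y ∈ Finset.range (N + 1), (∏ x, F Y (η x)) *
        Real.exp (-(θ Y * ((N : ℝ) - Y - ρ * L) + φ Y)) := by
    intro η hη
    rw [mem_piAntidiag_univ] at hη
    set Y := ∑ x, (if small (η x) then 0 else η x) with hY
    have hYN : Y ≤ N := by
      rw [hY, ← hη]
      exact Finset.sum_le_sum fun x _ => by split_ifs <;> simp
    have hterm : ∏ x, v (η x) ≤ (∏ x, F Y (η x)) *
        Real.exp (-(θ Y * ((N : ℝ) - Y - ρ * L) + φ Y)) := by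
      have e1 : ∏ x, F Y (η x) = (∏ x, v (η x)) *
          Real.exp (∑ x, if small (η x) then θ Y * ((η x : ℝ) - ρ) else φ (η x)) := by
        simp only [hF]
        rw [Finset.prod_mul_distrib, Real.exp_sum]
        congr 1
        exact Finset.prod_congr rfl fun x _ => by split_ifs <;> rfl
      have h1 : φ Y ≤ ∑ x, if small (η x) then 0 else φ (η x) := by
        refine (Finset.le_sum_of_subadditive φ hφ0.le hφ Finset.univ _).trans
          (Finset.sum_le_sum fun x _ => ?_)
        split_ifs
        · exact hφ0.le
        · exact le_rfl
      have h2 : θ Y * ((N : ℝ) - Y - ρ * L)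
          ≤ ∑ x, if small (η x) then θ Y * ((η x : ℝ) - ρ) else 0 := by
        have e2 : θ Y * ((N : ℝ) - Y - ρ * L)
            = ∑ x, θ Y * ((η x : ℝ) - (if small (η x) then 0 else (η x : ℝ)) - ρ) := by
          rw [← Finset.mul_sum, Finset.sum_sub_distrib, Finset.sum_sub_distrib, ← hη, hY]
          push_cast
          simp [mul_comm]
        rw [e2]
        refine Finset.sum_le_sum fun x _ => ?_
        split_ifs
        · simp
        · nlinarith [mul_nonneg (hθ Y) hρ]
      have h3 : ∑ x, (if small (η x) then θ Y * ((η x : ℝ) - ρ) else φ (η x))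
          = (∑ x, if small (η x) then θ Y * ((η x : ℝ) - ρ) else 0)
            + ∑ x, if small (η x) then 0 else φ (η x) := by
        rw [← Finset.sum_add_distrib]
        exact Finset.sum_congr rfl fun x _ => by split_ifs <;> simp
      rw [e1, mul_assoc, ← Real.exp_add]
      refine le_mul_of_one_le_right (Finset.prod_nonneg fun x _ => hv _) ?_
      apply Real.one_le_exp
      linarith
    exact hterm.trans (Finset.single_le_sum (f := fun Y => (∏ x, F Y (η x)) *
        Real.exp (-(θ Y * ((N : ℝ) - Y - ρ * L) + φ Y)))
      (fun Y _ => mul_nonneg (Finset.prod_nonneg fun x _ => hFnn _ _) (Real.exp_nonneg _))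
      (Finset.mem_range.2 (by omega)))
  calc confSum v L N ≤ ∑ η ∈ Finset.piAntidiag (Finset.univ : Finset (Fin L)) N,
        ∑ Y ∈ Finset.range (N + 1), (∏ x, F Y (η x)) *
        Real.exp (-(θ Y * ((N : ℝ) - Y - ρ * L) + φ Y)) := Finset.sum_le_sum hpt
    _ = ∑ Y ∈ Finset.range (N + 1), confSum (F Y) L N *
        Real.exp (-(θ Y * ((N : ℝ) - Y - ρ * L) + φ Y)) := by
        rw [Finset.sum_comm]
        exact Finset.sum_congr rfl fun Y _ => by rw [confSum, Finset.sum_mul]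
    _ ≤ _ := Finset.sum_le_sum fun Y _ =>
        mul_le_mul_of_nonneg_right (confSum_le_pow (hFnn Y) L N) (Real.exp_nonneg _)

/-- Putting the excess particles of a configuration on `L` sites on one further site. -/
lemma sum_le_confSum_succ {v : ℕ → ℝ} (hv : ∀ n, 0 ≤ v n) {L N : ℕ}
    (W : Finset (Fin L → ℕ)) (hW : ∀ ξ ∈ W, ∑ x, ξ x ≤ N) :
    ∑ ξ ∈ W, v (N - ∑ x, ξ x) * ∏ x, v (ξ x) ≤ confSum v (L + 1) N := by
  set e : (Fin L → ℕ) → (Fin (L + 1) → ℕ) := fun ξ => Fin.cons (N - ∑ x, ξ x) ξ with he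
  have hinj : Set.InjOn e W := by
    intro ξ _ ζ _ h
    exact (Fin.cons_inj.1 h).2
  have e1 : ∑ ξ ∈ W, v (N - ∑ x, ξ x) * ∏ x, v (ξ x) = ∑ η ∈ W.image e, ∏ x, v (η x) := by
    rw [Finset.sum_image hinj]
    refine Finset.sum_congr rfl fun ξ _ => ?_
    rw [Fin.prod_univ_succ]
    simp [he]
  rw [e1]
  refine Finset.sum_le_sum_of_subset_of_nonneg (fun η hη => ?_)
    fun η _ _ => Finset.prod_nonneg fun _ _ => hv _
  obtain ⟨ξ, hξ, rfl⟩ := Finset.mem_image.1 hη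
  rw [mem_piAntidiag_univ, Fin.sum_univ_succ]
  simp only [he, Fin.cons_zero, Fin.cons_succ]
  exact Nat.sub_add_cancel (hW ξ hξ)

/-- A lower bound for the weight of a window of densities: the tilted total weight minus
exponential Markov bounds for the two complementary events. -/
lemma sum_window_ge {v : ℕ → ℝ} (hv : ∀ n, 0 ≤ v n) (s : Finset ℕ) (L : ℕ)
    {θ p : ℝ} (hθ : 0 ≤ θ) (hp : 0 ≤ p) (ρ lo hi : ℝ) :
    Real.exp (-(θ * hi)) * ((∑ n ∈ s, v n * Real.exp (θ * ((n : ℝ) - ρ))) ^ L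
        - Real.exp (-(p * hi)) * (∑ n ∈ s, v n * Real.exp ((θ + p) * ((n : ℝ) - ρ))) ^ L
        - Real.exp (p * lo) * (∑ n ∈ s, v n * Real.exp ((θ - p) * ((n : ℝ) - ρ))) ^ L)
      ≤ ∑ ξ ∈ (Fintype.piFinset fun _ : Fin L => s).filter
          (fun ξ => lo ≤ (∑ x, (ξ x : ℝ)) - ρ * L ∧ (∑ x, (ξ x : ℝ)) - ρ * L ≤ hi),
          ∏ x, v (ξ x) := by
  have hpow : ∀ q : ℝ, (∑ n ∈ s, v n * Real.exp (q * ((n : ℝ) - ρ))) ^ L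
      = ∑ ξ ∈ Fintype.piFinset fun _ : Fin L => s,
        (∏ x, v (ξ x)) * Real.exp (q * ((∑ x, (ξ x : ℝ)) - ρ * L)) := by
    intro q
    have e : (∑ n ∈ s, v n * Real.exp (q * ((n : ℝ) - ρ))) ^ L
        = ∑ ξ ∈ Fintype.piFinset fun _ : Fin L => s,
          ∏ x, (v (ξ x) * Real.exp (q * ((ξ x : ℝ) - ρ))) := by
      rw [← Finset.prod_univ_sum (fun _ : Fin L => s)
        (fun _ n => v n * Real.exp (q * ((n : ℝ) - ρ)))]
      simp
    rw [e]
    refine Finset.sum_congr rfl fun ξ _ => ?_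
    rw [Finset.prod_mul_distrib, ← Real.exp_sum, ← Finset.mul_sum, Finset.sum_sub_distrib]
    simp [mul_comm]
  rw [hpow, hpow, hpow, Finset.mul_sum, Finset.mul_sum, ← Finset.sum_sub_distrib,
    ← Finset.sum_sub_distrib, Finset.mul_sum, Finset.sum_filter]
  refine Finset.sum_le_sum fun ξ _ => ?_
  set X := (∑ x, (ξ x : ℝ)) - ρ * L
  have hP : 0 ≤ ∏ x, v (ξ x) := Finset.prod_nonneg fun _ _ => hv _
  set P := ∏ x, v (ξ x)
  have e : Real.exp (-(θ * hi)) * (P * Real.exp (θ * X)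
      - Real.exp (-(p * hi)) * (P * Real.exp ((θ + p) * X))
      - Real.exp (p * lo) * (P * Real.exp ((θ - p) * X)))
      = P * (Real.exp (θ * (X - hi)) *
        (1 - Real.exp (p * (X - hi)) - Real.exp (p * (lo - X)))) := by
    have e1 : Real.exp ((θ + p) * X) = Real.exp (θ * X) * Real.exp (p * X) := by
      rw [← Real.exp_add]; ring_nf
    have e2 : Real.exp ((θ - p) * X) = Real.exp (θ * X) * Real.exp (-(p * X)) := by
      rw [← Real.exp_add]; ring_nf
    have e3 : Real.exp (θ * (X - hi)) = Real.exp (θ * X) * Real.exp (-(θ * hi)) := by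
      rw [← Real.exp_add]; ring_nf
    have e4 : Real.exp (p * (X - hi)) = Real.exp (p * X) * Real.exp (-(p * hi)) := by
      rw [← Real.exp_add]; ring_nf
    have e5 : Real.exp (p * (lo - X)) = Real.exp (p * lo) * Real.exp (-(p * X)) := by
      rw [← Real.exp_add]; ring_nf
    rw [e1, e2, e3, e4, e5]; ring
  rw [e]
  have hpos1 := Real.exp_pos (p * (X - hi))
  have hpos2 := Real.exp_pos (p * (lo - X))
  have hpos3 := Real.exp_pos (θ * (X - hi))
  split_ifs with h
  · have h1 : Real.exp (θ * (X - hi)) ≤ 1 :=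
      Real.exp_le_one_iff.2 (mul_nonpos_of_nonneg_of_nonpos hθ (by linarith [h.2]))
    refine mul_le_of_le_one_right hP ?_
    nlinarith
  · refine mul_nonpos_of_nonneg_of_nonpos hP (mul_nonpos_of_nonneg_of_nonpos hpos3.le ?_)
    rcases not_and_or.1 h with h | h
    · have := Real.one_le_exp (x := p * (lo - X)) (mul_nonneg hp (by linarith))
      linarith
    · have := Real.one_le_exp (x := p * (X - hi)) (mul_nonneg hp (by linarith))
      linarith

/-! ### The critical scale -/

lemma scaleExp_pos (hγ0 : 0 < γ) : 0 < scaleExp γ := by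
  rw [scaleExp]; positivity

lemma one_sub_two_mul_scaleExp_pos (hγ0 : 0 < γ) (hγ1 : γ < 1) : 0 < 1 - 2 * scaleExp γ := by
  have : 1 - 2 * scaleExp γ = (1 - γ) / (1 + γ) := by rw [scaleExp]; field_simp; ring
  rw [this]
  exact div_pos (by linarith) (by linarith)

lemma mul_rpow_neg_scaleExp_sq {x : ℝ} (hx : 0 < x) :
    x * (x ^ (-scaleExp γ)) ^ 2 = x ^ (1 - 2 * scaleExp γ) := by
  rw [← Real.rpow_natCast, ← Real.rpow_mul hx.le]
  nth_rewrite 1 [← Real.rpow_one x]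
  rw [← Real.rpow_add hx]
  congr 1
  push_cast
  ring

lemma rpow_neg_scaleExp_mul {x : ℝ} (hx : 0 < x) :
    x ^ (-scaleExp γ) * x ^ (1 - scaleExp γ) = x ^ (1 - 2 * scaleExp γ) := by
  rw [← Real.rpow_add hx]
  congr 1
  ring

lemma rpow_one_sub_scaleExp_rpow (hγ0 : 0 < γ) {x : ℝ} (hx : 0 < x) :
    (x ^ (1 - scaleExp γ)) ^ (1 - γ) = x ^ (1 - 2 * scaleExp γ) := by
  rw [← Real.rpow_mul hx.le]
  congr 1
  rw [scaleExp]
  field_simp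
  ring

lemma tendsto_natCast_rpow_neg_scaleExp (hγ0 : 0 < γ) :
    Tendsto (fun L : ℕ => (L : ℝ) ^ (-scaleExp γ)) atTop (𝓝 0) :=
  (tendsto_rpow_neg_atTop (scaleExp_pos hγ0)).comp tendsto_natCast_atTop_atTop

lemma tendsto_natCast_rpow_one_sub_two_mul (hγ0 : 0 < γ) (hγ1 : γ < 1) :
    Tendsto (fun L : ℕ => (L : ℝ) ^ (1 - 2 * scaleExp γ)) atTop atTop :=
  (tendsto_rpow_atTop (one_sub_two_mul_scaleExp_pos hγ0 hγ1)).comp tendsto_natCast_atTop_atTop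

lemma tendsto_natCast_rpow_one_sub (hγ0 : 0 < γ) (hγ1 : γ < 1) :
    Tendsto (fun L : ℕ => (L : ℝ) ^ (1 - scaleExp γ)) atTop atTop :=
  (tendsto_rpow_atTop (by linarith [one_sub_two_mul_scaleExp_pos hγ0 hγ1, scaleExp_pos hγ0])).comp
    tendsto_natCast_atTop_atTop

lemma rpow_neg_scaleExp_le_one (hγ0 : 0 < γ) {L : ℕ} (hL : 1 ≤ L) :
    (L : ℝ) ^ (-scaleExp γ) ≤ 1 :=
  Real.rpow_le_one_of_one_le_of_nonpos (by exact_mod_cast hL) (by linarith [scaleExp_pos hγ0])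

lemma AtCriticalScale.eventually_abs_le {d : ℝ} {N : ℕ → ℕ} (hN : AtCriticalScale γ b d N)
    {c : ℝ} (hc : 0 < c) : ∀ᶠ L : ℕ in atTop,
      |(N L : ℝ) - rhoC γ b * L - d * (L : ℝ) ^ (1 - scaleExp γ)|
        ≤ c * (L : ℝ) ^ (1 - scaleExp γ) := by
  filter_upwards [hN.def hc] with L hL
  rw [Real.norm_eq_abs, Real.norm_eq_abs,
    abs_of_nonneg (Real.rpow_nonneg (Nat.cast_nonneg L) (1 - scaleExp γ))] at hL
  rwa [sub_sub]

lemma AtCriticalScale.eventually_add_one_le_exp (hγ0 : 0 < γ) (hγ1 : γ < 1) {d : ℝ} (hd : 0 < d)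
    {N : ℕ → ℕ} (hN : AtCriticalScale γ b d N) {η : ℝ} (hη : 0 < η) :
    ∀ᶠ L : ℕ in atTop, (N L : ℝ) + 1 ≤ Real.exp ((L : ℝ) ^ (1 - 2 * scaleExp γ) * η) := by
  have hlog : ∀ᶠ L : ℕ in atTop, Real.log L ≤ η / 2 * (L : ℝ) ^ (1 - 2 * scaleExp γ) := by
    have h := tendsto_natCast_atTop_atTop.eventually
      ((isLittleO_log_rpow_atTop (one_sub_two_mul_scaleExp_pos hγ0 hγ1)).def
        (show 0 < η / 2 by linarith))
    filter_upwards [h] with L hL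
    rw [Real.norm_eq_abs, Real.norm_eq_abs,
      abs_of_nonneg (Real.rpow_nonneg (Nat.cast_nonneg L) (1 - 2 * scaleExp γ))] at hL
    exact (le_abs_self _).trans hL
  have hconst : ∀ᶠ L : ℕ in atTop, Real.log (|rhoC γ b| + d + 2)
      ≤ (L : ℝ) ^ (1 - 2 * scaleExp γ) * (η / 2) :=
    ((tendsto_natCast_rpow_one_sub_two_mul hγ0 hγ1).atTop_mul_const
      (show 0 < η / 2 by linarith)).eventually_ge_atTop _
  filter_upwards [hlog, hconst, hN.eventually_abs_le one_pos, eventually_ge_atTop 1]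
    with L h1 h2 h3 hL
  have hL1 : (1 : ℝ) ≤ L := by exact_mod_cast hL
  have hL0 : (0 : ℝ) < L := by linarith
  have hl : (L : ℝ) ^ (1 - scaleExp γ) ≤ L := by
    conv_rhs => rw [← Real.rpow_one (L : ℝ)]
    exact Real.rpow_le_rpow_of_exponent_le hL1 (by linarith [scaleExp_pos hγ0])
  have hl0 : 0 ≤ (L : ℝ) ^ (1 - scaleExp γ) := by positivity
  have h4 : (N L : ℝ) + 1 ≤ (|rhoC γ b| + d + 2) * L := by
    have h5 := (abs_le.1 h3).2
    have h6 : rhoC γ b * L ≤ |rhoC γ b| * L := by gcongr; exact le_abs_self _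
    have h7 : d * (L : ℝ) ^ (1 - scaleExp γ) ≤ d * L := by gcongr
    linarith
  have hc : 0 < |rhoC γ b| + d + 2 := by positivity
  calc (N L : ℝ) + 1 ≤ (|rhoC γ b| + d + 2) * L := h4
    _ = Real.exp (Real.log (|rhoC γ b| + d + 2) + Real.log L) := by
      rw [Real.exp_add, Real.exp_log hc, Real.exp_log hL0]
    _ ≤ _ := by
      apply Real.exp_le_exp.2
      linarith

/-! ### Upper bound for tilted partition functions -/

/-- The exponent of the Markov bound for configurations with `y` rescaled particles on large
sites, with the optimal slope `r / σ²`, where `r = max (d - y) 0`. -/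
lemma chernoff_exponent_le (hγ1 : γ < 1) (hb : 0 < b) (hV : 0 < varC γ b)
    {d t m ε y : ℝ} (hd : 0 < d)
    (hm : ∀ r ∈ Set.Icc 0 d, m ≤ rateFunAux γ b d r - t * r / varC γ b)
    (hε0 : 0 ≤ ε) (hε1 : ε ≤ 1) (hy : 0 ≤ y) :
    ((max (d - y) 0 / varC γ b) ^ 2 * varC γ b + 2 * (max (d - y) 0 / varC γ b) * t
        + t ^ 2 * rateVar γ b) / 2
      - max (d - y) 0 / varC γ b * (d - y) - (1 - ε) * jumpCost γ b y
      ≤ -m + t ^ 2 * rateVar γ b / 2 + ε * jumpCost γ b d := by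
  set V := varC γ b
  set r := max (d - y) 0 with hr
  have hr0 : 0 ≤ r := le_max_right _ _
  have hrd : r ≤ d := max_le (by linarith) hd.le
  have h1 := hm r ⟨hr0, hrd⟩
  have h2 : r / V * (d - y) = r ^ 2 / V := by
    rcases le_total (d - y) 0 with h | h
    · rw [hr, max_eq_right h]; simp
    · rw [hr, max_eq_left h]; ring
  have h3 : jumpCost γ b (d - r) ≤ jumpCost γ b y :=
    jumpCost_mono hγ1 hb (by linarith) (by linarith [le_max_left (d - y) 0])
  have h4 : jumpCost γ b (d - r) ≤ jumpCost γ b d :=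
    jumpCost_mono hγ1 hb (by linarith) (by linarith)
  have h5 : (1 - ε) * jumpCost γ b (d - r) ≤ (1 - ε) * jumpCost γ b y :=
    mul_le_mul_of_nonneg_left h3 (by linarith)
  have h6 : ε * jumpCost γ b (d - r) ≤ ε * jumpCost γ b d := mul_le_mul_of_nonneg_left h4 hε0
  have h7 : rateFunAux γ b d r = r ^ 2 / (2 * V) + jumpCost γ b (d - r) := rfl
  have h8 : ((r / V) ^ 2 * V + 2 * (r / V) * t + t ^ 2 * rateVar γ b) / 2 - r ^ 2 / V
      = -(r ^ 2 / (2 * V)) + t * r / V + t ^ 2 * rateVar γ b / 2 := by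
    field_simp
    ring
  rw [h2]
  linarith

lemma tiltedWeight_pos (hb : 0 < b) (τ : ℝ) (n : ℕ) : 0 < tiltedWeight γ b τ n :=
  mul_pos (weight_pos hb n) (Real.exp_pos _)

/-- One-site generating function with linear tilt on small sites and almost full compensation of
the jump cost on large sites. -/
lemma exists_site_bound (hγ0 : 0 < γ) (hγ1 : γ < 1) (hb : 0 < b) {K t c : ℝ} (hK : 0 < K)
    (ht : |t| ≤ K) (hc0 : 0 ≤ c) (hc : c < 1) :
    ∃ δ : ℝ, ∃ C : ℝ, 0 ≤ C ∧ ∀ a θ : ℝ, 0 < a → a ≤ 1 → |θ| ≤ K → ∀ s : Finset ℕ,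
      ∑ n ∈ s, tiltedWeight γ b (t * a) n * (if a * (n : ℝ) ^ γ ≤ δ then
          Real.exp (a * θ * ((n : ℝ) - rhoC γ b)) else Real.exp (c * jumpCost γ b n))
        ≤ critZ γ b * Real.exp (a ^ 2 *
          ((θ ^ 2 * varC γ b + 2 * θ * t + t ^ 2 * rateVar γ b) / 2 + C * a)) := by
  have hz := critZ_pos hγ0 hγ1 hb
  obtain ⟨δ, hδ, C₁, hC₁, h₁⟩ := exists_mgf_bounds hγ0 hγ1 hb hK
  obtain ⟨C₂, hC₂, h₂⟩ := exists_sum_large_le hγ0 hγ1 hb hc0 hc hδ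
  set G := Real.exp (K * (1 + b)) with hG
  have hGpos : 0 < G := Real.exp_pos _
  refine ⟨δ, (C₁ + G * C₂) / critZ γ b, by positivity, fun a θ ha ha1 hθ s => ?_⟩
  have hsmall := (h₁ a θ t ha ha1 hθ ht (s.filter fun n : ℕ => a * (n : ℝ) ^ γ ≤ δ)
    (fun n hn => (Finset.mem_filter.1 hn).2)).1
  have hlarge := h₂ a ha (s.filter fun n : ℕ => ¬ a * (n : ℝ) ^ γ ≤ δ)
    (fun n hn => lt_of_not_ge (Finset.mem_filter.1 hn).2)
  rw [← Finset.sum_filter_add_sum_filter_not s (fun n : ℕ => a * (n : ℝ) ^ γ ≤ δ)]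
  have e1 : ∑ n ∈ s.filter (fun n : ℕ => a * (n : ℝ) ^ γ ≤ δ),
      tiltedWeight γ b (t * a) n * (if a * (n : ℝ) ^ γ ≤ δ then
          Real.exp (a * θ * ((n : ℝ) - rhoC γ b)) else Real.exp (c * jumpCost γ b n))
      = ∑ n ∈ s.filter (fun n : ℕ => a * (n : ℝ) ^ γ ≤ δ), weight γ b n *
          Real.exp (a * (θ * ((n : ℝ) - rhoC γ b) + t * (rate γ b n - 1))) := by
    refine Finset.sum_congr rfl fun n hn => ?_
    rw [if_pos (Finset.mem_filter.1 hn).2, tiltedWeight, mul_assoc, ← Real.exp_add]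
    ring_nf
  have e2 : ∑ n ∈ s.filter (fun n : ℕ => ¬ a * (n : ℝ) ^ γ ≤ δ),
      tiltedWeight γ b (t * a) n * (if a * (n : ℝ) ^ γ ≤ δ then
          Real.exp (a * θ * ((n : ℝ) - rhoC γ b)) else Real.exp (c * jumpCost γ b n))
      ≤ G * ∑ n ∈ s.filter (fun n : ℕ => ¬ a * (n : ℝ) ^ γ ≤ δ), weight γ b n *
          Real.exp (c * jumpCost γ b n) := by
    rw [Finset.mul_sum]
    refine Finset.sum_le_sum fun n hn => ?_
    rw [if_neg (Finset.mem_filter.1 hn).2, tiltedWeight]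
    have h3 : Real.exp (t * a * (rate γ b n - 1)) ≤ G := by
      apply Real.exp_le_exp.2
      calc t * a * (rate γ b n - 1) ≤ |t * a * (rate γ b n - 1)| := le_abs_self _
        _ = |t| * a * |rate γ b n - 1| := by rw [abs_mul, abs_mul, abs_of_pos ha]
        _ ≤ K * 1 * (1 + b) := by
            gcongr
            exact abs_rate_sub_one_le hγ0 hb n
        _ = K * (1 + b) := by ring
    calc weight γ b n * Real.exp (t * a * (rate γ b n - 1)) * Real.exp (c * jumpCost γ b n)
        = Real.exp (t * a * (rate γ b n - 1)) * (weight γ b n * Real.exp (c * jumpCost γ b n)) := by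
          ring
      _ ≤ _ := mul_le_mul_of_nonneg_right h3
          (mul_nonneg (weight_pos hb n).le (Real.exp_nonneg _))
  rw [e1]
  have h5 : G * ∑ n ∈ s.filter (fun n : ℕ => ¬ a * (n : ℝ) ^ γ ≤ δ), weight γ b n *
          Real.exp (c * jumpCost γ b n) ≤ G * (C₂ * a ^ 3) :=
    mul_le_mul_of_nonneg_left hlarge hGpos.le
  refine (add_le_add hsmall (e2.trans h5)).trans ?_
  have h6 := Real.add_one_le_exp (a ^ 2 *
    ((θ ^ 2 * varC γ b + 2 * θ * t + t ^ 2 * rateVar γ b) / 2 + (C₁ + G * C₂) / critZ γ b * a))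
  refine le_trans (le_of_eq ?_) (mul_le_mul_of_nonneg_left h6 hz.le)
  field_simp
  ring

/-- Upper large-deviation bound for the tilted partition function: the exponent is governed by
the minimum over `r` of the rate function minus the linear gain `t r / σ²`. -/
lemma eventually_confSum_tilted_le (hγ0 : 0 < γ) (hγ1 : γ < 1) (hb : 0 < b) {d : ℝ} (hd : 0 < d)
    {N : ℕ → ℕ} (hN : AtCriticalScale γ b d N) {t m : ℝ}
    (hm : ∀ r ∈ Set.Icc 0 d, m ≤ rateFunAux γ b d r - t * r / varC γ b) {η : ℝ} (hη : 0 < η) :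
    ∀ᶠ L : ℕ in atTop, confSum (tiltedWeight γ b (t * (L : ℝ) ^ (-scaleExp γ))) L (N L)
      ≤ critZ γ b ^ L * Real.exp ((L : ℝ) ^ (1 - 2 * scaleExp γ)
          * (-m + t ^ 2 * rateVar γ b / 2 + η)) := by
  have hV := varC_pos hγ0 hγ1 hb
  have hz := critZ_pos hγ0 hγ1 hb
  have hρ := rhoC_pos hγ0 hγ1 hb
  have hhd := jumpCost_nonneg hγ1 hb hd.le
  obtain ⟨ε, hε0, hε1, hεη⟩ : ∃ ε : ℝ, 0 < ε ∧ ε ≤ 1 ∧ ε * jumpCost γ b d ≤ η / 4 := by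
    refine ⟨min 1 (η / 4 / (jumpCost γ b d + 1)), by positivity, min_le_left _ _, ?_⟩
    calc _ ≤ η / 4 / (jumpCost γ b d + 1) * (jumpCost γ b d + 1) := by
          gcongr
          · exact min_le_right _ _
          · linarith
      _ = η / 4 := by field_simp
  set K : ℝ := d / varC γ b + |t| + 1 with hK
  have hKpos : 0 < K := by positivity
  obtain ⟨δ, C, hC, hsite⟩ := exists_site_bound hγ0 hγ1 hb hKpos (t := t) (c := 1 - ε)
    (by rw [hK]; linarith [div_nonneg hd.le hV.le]) (by linarith) (by linarith)
  have ev1 : ∀ᶠ L : ℕ in atTop, C * (L : ℝ) ^ (-scaleExp γ) < η / 4 := by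
    have := (tendsto_natCast_rpow_neg_scaleExp hγ0).const_mul C
    rw [mul_zero] at this
    exact this.eventually (Iio_mem_nhds (by linarith))
  have ev2 := hN.eventually_abs_le (c := η / 4 / K) (by positivity)
  have ev3 := hN.eventually_add_one_le_exp hγ0 hγ1 hd (η := η / 4) (by linarith)
  filter_upwards [ev1, ev2, ev3, eventually_ge_atTop 1] with L h1 h2 h3 hL
  have hL0 : (0 : ℝ) < L := by exact_mod_cast hL
  have ha : 0 < (L : ℝ) ^ (-scaleExp γ) := by positivity
  have ha1 := rpow_neg_scaleExp_le_one hγ0 hL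
  have hl : 0 < (L : ℝ) ^ (1 - scaleExp γ) := by positivity
  have hLa := mul_rpow_neg_scaleExp_sq (γ := γ) hL0
  have hal := rpow_neg_scaleExp_mul (γ := γ) hL0
  have hlT := rpow_one_sub_scaleExp_rpow hγ0 hL0
  have hT : 0 < (L : ℝ) ^ (1 - 2 * scaleExp γ) := by positivity
  set a := (L : ℝ) ^ (-scaleExp γ)
  set l := (L : ℝ) ^ (1 - scaleExp γ)
  set T := (L : ℝ) ^ (1 - 2 * scaleExp γ)
  -- the slope that is optimal for the excess density left to the small sites
  set θ : ℕ → ℝ := fun Y => max (d - Y / l) 0 / varC γ b with hθ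
  have hθ0 : ∀ Y, 0 ≤ θ Y := fun Y => div_nonneg (le_max_right _ _) hV.le
  have hθK : ∀ Y, θ Y ≤ K := by
    intro Y
    have hy : 0 ≤ (Y : ℝ) / l := by positivity
    have : θ Y ≤ d / varC γ b := by
      simp only [hθ]
      gcongr
      exact max_le (by linarith) hd.le
    rw [hK]
    linarith [abs_nonneg t]
  have hsum := confSum_le_sum_large (v := tiltedWeight γ b (t * a))
    (φ := fun n => (1 - ε) * jumpCost γ b n) (fun n => (tiltedWeight_pos hb _ n).le)
    (by simp [jumpCost_zero hγ1])
    (fun m n => by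
      rw [← mul_add, Nat.cast_add]
      exact mul_le_mul_of_nonneg_left
        (jumpCost_add_le hγ0 hγ1 hb m.cast_nonneg n.cast_nonneg) (by linarith))
    (fun n : ℕ => a * (n : ℝ) ^ γ ≤ δ) hρ.le (θ := fun Y => a * θ Y)
    (fun Y => mul_nonneg ha.le (hθ0 Y)) L (N L)
  refine hsum.trans ?_
  have hterm : ∀ Y ∈ Finset.range (N L + 1),
      (∑ n ∈ Finset.range (N L + 1), tiltedWeight γ b (t * a) n *
        (if a * (n : ℝ) ^ γ ≤ δ then Real.exp (a * θ Y * ((n : ℝ) - rhoC γ b))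
          else Real.exp ((1 - ε) * jumpCost γ b n))) ^ L
      * Real.exp (-(a * θ Y * ((N L : ℝ) - Y - rhoC γ b * L) + (1 - ε) * jumpCost γ b Y))
      ≤ critZ γ b ^ L * Real.exp (T * (-m + t ^ 2 * rateVar γ b / 2 + 3 * (η / 4))) := by
    intro Y _
    have hs := hsite a (θ Y) ha ha1 (by rw [abs_of_nonneg (hθ0 Y)]; exact hθK Y)
      (Finset.range (N L + 1))
    have hs' := pow_le_pow_left₀ (Finset.sum_nonneg fun n _ =>
      mul_nonneg (tiltedWeight_pos hb _ n).le (by split_ifs <;> positivity)) hs L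
    refine (mul_le_mul_of_nonneg_right hs' (Real.exp_nonneg _)).trans ?_
    rw [mul_pow, ← Real.exp_nat_mul, mul_assoc, ← Real.exp_add]
    apply mul_le_mul_of_nonneg_left _ (pow_nonneg hz.le L)
    apply Real.exp_le_exp.2
    have hY : jumpCost γ b Y = T * jumpCost γ b (Y / l) := by
      rw [← hlT, ← jumpCost_mul hl.le (by positivity), mul_div_cancel₀ _ hl.ne']
    have hexp := chernoff_exponent_le hγ1 hb hV hd hm hε0.le hε1 (y := (Y : ℝ) / l) (by positivity)
    change ((θ Y) ^ 2 * varC γ b + 2 * θ Y * t + t ^ 2 * rateVar γ b) / 2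
      - θ Y * (d - Y / l) - (1 - ε) * jumpCost γ b (Y / l) ≤ _ at hexp
    have hdev : -(a * θ Y * ((N L : ℝ) - rhoC γ b * L - d * l)) ≤ T * (η / 4) := by
      calc -(a * θ Y * ((N L : ℝ) - rhoC γ b * L - d * l))
          ≤ |a * θ Y * ((N L : ℝ) - rhoC γ b * L - d * l)| := neg_le_abs _
        _ = a * θ Y * |(N L : ℝ) - rhoC γ b * L - d * l| := by
            rw [abs_mul, abs_of_nonneg (mul_nonneg ha.le (hθ0 Y))]
        _ ≤ a * K * (η / 4 / K * l) := by
            gcongr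
            exact hθK Y
        _ = a * l * (η / 4) := by field_simp
        _ = T * (η / 4) := by rw [hal]
    have e : (L : ℝ) * (a ^ 2 * ((θ Y ^ 2 * varC γ b + 2 * θ Y * t + t ^ 2 * rateVar γ b) / 2
          + C * a)) + -(a * θ Y * ((N L : ℝ) - Y - rhoC γ b * L) + (1 - ε) * jumpCost γ b Y)
        = T * (((θ Y) ^ 2 * varC γ b + 2 * θ Y * t + t ^ 2 * rateVar γ b) / 2
          - θ Y * (d - Y / l) - (1 - ε) * jumpCost γ b (Y / l)) + T * (C * a)
          + -(a * θ Y * ((N L : ℝ) - rhoC γ b * L - d * l)) := by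
      rw [hY]
      have hYl : (Y : ℝ) = l * (Y / l) := by rw [mul_div_cancel₀ _ hl.ne']
      have e3 : a * θ Y * ((N L : ℝ) - Y - rhoC γ b * L)
          = a * θ Y * ((N L : ℝ) - rhoC γ b * L - d * l) + a * l * (θ Y * (d - Y / l)) := by
        conv_lhs => rw [hYl]
        ring
      rw [e3, hal, ← mul_assoc (L : ℝ), hLa]
      ring
    rw [e]
    have h7 := mul_le_mul_of_nonneg_left hexp hT.le
    have h8 := mul_le_mul_of_nonneg_left h1.le hT.le
    have h9 := mul_le_mul_of_nonneg_left hεη hT.le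
    calc _ ≤ T * (-m + t ^ 2 * rateVar γ b / 2 + ε * jumpCost γ b d) + T * (η / 4)
          + T * (η / 4) := add_le_add (add_le_add h7 h8) hdev
      _ ≤ _ := by linarith
  refine (Finset.sum_le_card_nsmul _ _ _ hterm).trans ?_
  rw [Finset.card_range, nsmul_eq_mul, Nat.cast_add, Nat.cast_one]
  calc ((N L : ℝ) + 1) * (critZ γ b ^ L *
        Real.exp (T * (-m + t ^ 2 * rateVar γ b / 2 + 3 * (η / 4))))
      ≤ Real.exp (T * (η / 4)) * (critZ γ b ^ L *
        Real.exp (T * (-m + t ^ 2 * rateVar γ b / 2 + 3 * (η / 4)))) := by gcongr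
    _ = critZ γ b ^ L * (Real.exp (T * (η / 4)) *
        Real.exp (T * (-m + t ^ 2 * rateVar γ b / 2 + 3 * (η / 4)))) := by ring
    _ = _ := by
      rw [← Real.exp_add]
      congr 2
      ring

/-! ### Lower bound for the partition function -/

lemma exists_finset_mem_iff (hγ0 : 0 < γ) {a δ : ℝ} (ha : 0 < a) :
    ∃ s : Finset ℕ, ∀ n : ℕ, n ∈ s ↔ a * (n : ℝ) ^ γ ≤ δ := by
  have h : Tendsto (fun n : ℕ => a * (n : ℝ) ^ γ) atTop atTop :=
    ((tendsto_rpow_atTop hγ0).comp tendsto_natCast_atTop_atTop).const_mul_atTop ha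
  obtain ⟨n0, hn0⟩ := eventually_atTop.1 (h.eventually_gt_atTop δ)
  refine ⟨(Finset.range n0).filter fun n : ℕ => a * (n : ℝ) ^ γ ≤ δ, fun n => ?_⟩
  rw [Finset.mem_filter, Finset.mem_range]
  refine ⟨fun h => h.2, fun h => ⟨?_, h⟩⟩
  by_contra hn
  exact absurd (hn0 n (not_lt.1 hn)) (not_lt.2 h)

/-- Gaussian asymptotics on the exponential scale for powers of the truncated moment generating
function at a finite set of slopes `θ ∈ Θ`. -/
lemma eventually_mgf_pow_bounds (hγ0 : 0 < γ) (hγ1 : γ < 1) (hb : 0 < b) (Θ : Finset ℝ)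
    {η : ℝ} (hη : 0 < η) :
    ∀ᶠ L : ℕ in atTop, ∃ s : Finset ℕ, ∀ θ ∈ Θ,
      ((∑ n ∈ s, weight γ b n * Real.exp (θ * ((L + 1 : ℕ) : ℝ) ^ (-scaleExp γ)
          * ((n : ℝ) - rhoC γ b))) ^ L
        ≤ critZ γ b ^ L * Real.exp (((L + 1 : ℕ) : ℝ) ^ (1 - 2 * scaleExp γ)
          * (θ ^ 2 * varC γ b / 2 + η))) ∧
      (0 < θ → critZ γ b ^ L * Real.exp (((L + 1 : ℕ) : ℝ) ^ (1 - 2 * scaleExp γ)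
          * (θ ^ 2 * varC γ b / 2 - η))
        ≤ (∑ n ∈ s, weight γ b n * Real.exp (θ * ((L + 1 : ℕ) : ℝ) ^ (-scaleExp γ)
          * ((n : ℝ) - rhoC γ b))) ^ L) := by
  have hV := varC_pos hγ0 hγ1 hb
  have hz := critZ_pos hγ0 hγ1 hb
  set K : ℝ := ∑ θ ∈ Θ, |θ| + 1 with hK
  have hKpos : 0 < K := by positivity
  have hθK : ∀ θ ∈ Θ, |θ| ≤ K := fun θ hθ => by
    have := Finset.single_le_sum (f := fun θ : ℝ => |θ|) (fun i _ => abs_nonneg i) hθ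
    linarith
  obtain ⟨δ, hδ, C, hC, hmgf⟩ := exists_mgf_bounds hγ0 hγ1 hb hKpos
  -- the ratio `c < 1` absorbs the errors in `exp (c x) ≤ 1 + x` and in `c (L + 1) ≤ L`
  set A : ℝ := K ^ 2 * varC γ b / 2 with hA
  have hApos : 0 < A := by positivity
  obtain ⟨c, hc0, hc1, hcA⟩ : ∃ c : ℝ, 0 < c ∧ c < 1 ∧ (1 - c ^ 2) * A ≤ η / 2 := by
    have hcont : Tendsto (fun c : ℝ => (1 - c ^ 2) * A) (𝓝[<] 1) (𝓝 ((1 - 1 ^ 2) * A)) :=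
      ((by fun_prop : Continuous fun c : ℝ => (1 - c ^ 2) * A).tendsto 1).mono_left
        nhdsWithin_le_nhds
    have h1 := hcont.eventually (Iic_mem_nhds (show (1 - 1 ^ 2) * A < η / 2 by simpa using hη))
    have h2 : ∀ᶠ c : ℝ in 𝓝[<] 1, c ∈ Set.Ioo (0 : ℝ) 1 := Ioo_mem_nhdsLT one_pos
    obtain ⟨c, hc, hc'⟩ := (h1.and h2).exists
    exact ⟨c, hc'.1, hc'.2, hc⟩
  have htend := tendsto_natCast_rpow_neg_scaleExp hγ0
  have ev1 : ∀ᶠ M : ℕ in atTop, C / critZ γ b * (M : ℝ) ^ (-scaleExp γ) < η / 2 := by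
    have := htend.const_mul (C / critZ γ b)
    rw [mul_zero] at this
    exact this.eventually (Iio_mem_nhds (by linarith))
  have ev2 : ∀ᶠ M : ℕ in atTop, ∀ θ ∈ Θ, 0 < θ →
      C / critZ γ b * (M : ℝ) ^ (-scaleExp γ) < θ ^ 2 * varC γ b / 2 := by
    refine (Finset.eventually_all Θ).2 fun θ _ => ?_
    by_cases hθ : 0 < θ
    · have := htend.const_mul (C / critZ γ b)
      rw [mul_zero] at this
      filter_upwards [this.eventually (Iio_mem_nhds
        (show 0 < θ ^ 2 * varC γ b / 2 by positivity))] with M hM _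
      exact hM
    · exact Eventually.of_forall fun M h => absurd h hθ
  have ev3 : ∀ᶠ M : ℕ in atTop, ((M : ℝ) ^ (-scaleExp γ)) ^ 2 * A < 1 - c := by
    have := (htend.pow 2).mul_const A
    rw [zero_pow two_ne_zero, zero_mul] at this
    exact this.eventually (Iio_mem_nhds (by linarith))
  have ev4 : ∀ᶠ M : ℕ in atTop, 1 ≤ (1 - c) * (M : ℝ) :=
    (tendsto_natCast_atTop_atTop.const_mul_atTop (show 0 < 1 - c by linarith)).eventually_ge_atTop 1
  filter_upwards [(tendsto_add_atTop_nat 1).eventually ev1,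
    (tendsto_add_atTop_nat 1).eventually ev2, (tendsto_add_atTop_nat 1).eventually ev3,
    (tendsto_add_atTop_nat 1).eventually ev4] with L h1 h2 h3 h4
  have hM0 : (0 : ℝ) < ((L + 1 : ℕ) : ℝ) := by positivity
  have ha : 0 < ((L + 1 : ℕ) : ℝ) ^ (-scaleExp γ) := by positivity
  have ha1 := rpow_neg_scaleExp_le_one hγ0 (show 1 ≤ L + 1 by omega)
  have hLa := mul_rpow_neg_scaleExp_sq (γ := γ) hM0
  have hT : 0 < ((L + 1 : ℕ) : ℝ) ^ (1 - 2 * scaleExp γ) := by positivity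
  have hML : (L : ℝ) = ((L + 1 : ℕ) : ℝ) - 1 := by push_cast; ring
  set a := ((L + 1 : ℕ) : ℝ) ^ (-scaleExp γ)
  set T := ((L + 1 : ℕ) : ℝ) ^ (1 - 2 * scaleExp γ)
  set M := ((L + 1 : ℕ) : ℝ)
  obtain ⟨s, hs⟩ := exists_finset_mem_iff (δ := δ) hγ0 ha
  refine ⟨s, fun θ hθ => ?_⟩
  obtain ⟨hup, hlow⟩ := hmgf a θ 0 ha ha1 (hθK θ hθ) (by simpa using hKpos.le) s
    (fun n hn => (hs n).1 hn)
  replace hlow := hlow fun n hn => (hs n).2 hn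
  have e : ∑ n ∈ s, weight γ b n *
      Real.exp (a * (θ * ((n : ℝ) - rhoC γ b) + 0 * (rate γ b n - 1)))
      = ∑ n ∈ s, weight γ b n * Real.exp (θ * a * ((n : ℝ) - rhoC γ b)) :=
    Finset.sum_congr rfl fun n _ => by ring_nf
  rw [e] at hup hlow
  set B := ∑ n ∈ s, weight γ b n * Real.exp (θ * a * ((n : ℝ) - rhoC γ b))
  have hB0 : 0 ≤ B := Finset.sum_nonneg fun n _ =>
    mul_nonneg (weight_pos hb n).le (Real.exp_nonneg _)
  have hup' : B ≤ critZ γ b * Real.exp (a ^ 2 * (θ ^ 2 * varC γ b / 2 + C / critZ γ b * a)) := by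
    have h6 := Real.add_one_le_exp (a ^ 2 * (θ ^ 2 * varC γ b / 2 + C / critZ γ b * a))
    refine hup.trans (le_trans (le_of_eq ?_) (mul_le_mul_of_nonneg_left h6 hz.le))
    field_simp
    ring
  constructor
  · refine (pow_le_pow_left₀ hB0 hup' L).trans ?_
    rw [mul_pow, ← Real.exp_nat_mul]
    apply mul_le_mul_of_nonneg_left _ (pow_nonneg hz.le L)
    apply Real.exp_le_exp.2
    calc (L : ℝ) * (a ^ 2 * (θ ^ 2 * varC γ b / 2 + C / critZ γ b * a))
        ≤ M * (a ^ 2 * (θ ^ 2 * varC γ b / 2 + C / critZ γ b * a)) := by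
          gcongr
          linarith
      _ = T * (θ ^ 2 * varC γ b / 2 + C / critZ γ b * a) := by rw [← mul_assoc, hLa]
      _ ≤ _ := by gcongr; linarith
  · intro hθ0
    have h2' := h2 θ hθ hθ0
    set x := a ^ 2 * (θ ^ 2 * varC γ b / 2 - C / critZ γ b * a) with hx
    have hx0 : 0 ≤ x := mul_nonneg (sq_nonneg _) (by linarith)
    have hCa : 0 ≤ C / critZ γ b * a := by positivity
    have hθA : θ ^ 2 * varC γ b / 2 ≤ A := by
      have : θ ≤ K := (le_abs_self θ).trans (hθK θ hθ)
      rw [hA]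
      gcongr
    have hx1 : x ≤ 1 - c := by
      refine le_trans ?_ h3.le
      rw [hx]
      gcongr
      linarith
    have hlow' : critZ γ b * Real.exp (c * x) ≤ B := by
      refine (mul_le_mul_of_nonneg_left (exp_mul_le_one_add hc0.le hc1 hx0 hx1) hz.le).trans
        (le_trans (le_of_eq ?_) hlow)
      rw [hx]
      field_simp
      ring
    refine le_trans ?_ (pow_le_pow_left₀ (by positivity) hlow' L)
    rw [mul_pow, ← Real.exp_nat_mul]
    apply mul_le_mul_of_nonneg_left _ (pow_nonneg hz.le L)
    apply Real.exp_le_exp.2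
    have hcM : c * M ≤ L := by linarith
    calc T * (θ ^ 2 * varC γ b / 2 - η)
        ≤ T * (c ^ 2 * (θ ^ 2 * varC γ b / 2 - C / critZ γ b * a)) := by
          apply mul_le_mul_of_nonneg_left _ hT.le
          have h7 : (1 - c ^ 2) * (θ ^ 2 * varC γ b / 2) ≤ (1 - c ^ 2) * A :=
            mul_le_mul_of_nonneg_left hθA (by nlinarith)
          have h8 : c ^ 2 * (C / critZ γ b * a) ≤ 1 * (C / critZ γ b * a) :=
            mul_le_mul_of_nonneg_right (by nlinarith) hCa
          linarith
      _ = c * M * (c * x) := by rw [← hLa, hx]; ring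
      _ ≤ L * (c * x) := by gcongr

/-- Lower large-deviation bound: for every `r` in `(0, d)` one site may take `(d - r) L ^ (1 - α)`
particles, while the remaining sites realise the excess density `r` within a small window. The
exact number of particles is adjusted on the exceptional site, so that no local limit theorem is
needed. -/
lemma eventually_le_partitionZ (hγ0 : 0 < γ) (hγ1 : γ < 1) (hb : 0 < b) {d : ℝ}
    {N : ℕ → ℕ} (hN : AtCriticalScale γ b d N) {r : ℝ} (hr : r ∈ Set.Ioo 0 d)
    {η : ℝ} (hη : 0 < η) :
    ∀ᶠ L : ℕ in atTop, critZ γ b ^ L * Real.exp (-((L : ℝ) ^ (1 - 2 * scaleExp γ)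
          * (rateFunAux γ b d r + η))) ≤ partitionZ γ b L (N L) := by
  have hV := varC_pos hγ0 hγ1 hb
  have hz := critZ_pos hγ0 hγ1 hb
  have hρ := rhoC_pos hγ0 hγ1 hb
  obtain ⟨hr0, hrd⟩ := hr
  obtain ⟨ε, hε0, hεr, hεd, hεη, hεh⟩ : ∃ ε : ℝ, 0 < ε ∧ ε < r ∧ 2 * ε < d - r ∧
      r * ε / varC γ b < η / 4 ∧
      jumpCost γ b (d - r + 2 * ε) < jumpCost γ b (d - r) + η / 4 := by
    have c1 : Tendsto (fun ε : ℝ => 2 * ε) (𝓝[>] 0) (𝓝 (2 * 0)) :=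
      ((by fun_prop : Continuous fun ε : ℝ => 2 * ε).tendsto 0).mono_left nhdsWithin_le_nhds
    have c2 : Tendsto (fun ε : ℝ => r * ε / varC γ b) (𝓝[>] 0) (𝓝 (r * 0 / varC γ b)) :=
      ((by fun_prop : Continuous fun ε : ℝ => r * ε / varC γ b).tendsto 0).mono_left
        nhdsWithin_le_nhds
    have c3 : Tendsto (fun ε : ℝ => jumpCost γ b (d - r + 2 * ε)) (𝓝[>] 0)
        (𝓝 (jumpCost γ b (d - r + 2 * 0))) :=
      (((continuous_jumpCost hγ1).comp
        (by fun_prop : Continuous fun ε : ℝ => d - r + 2 * ε)).tendsto 0).mono_left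
        nhdsWithin_le_nhds
    have h0 : ∀ᶠ ε : ℝ in 𝓝[>] 0, ε ∈ Set.Ioo 0 r := Ioo_mem_nhdsGT hr0
    have h1 := c1.eventually (Iio_mem_nhds (show 2 * 0 < d - r by linarith))
    have h2 := c2.eventually (Iio_mem_nhds (show r * 0 / varC γ b < η / 4 by simp; linarith))
    have h3 := c3.eventually (Iio_mem_nhds (show jumpCost γ b (d - r + 2 * 0)
      < jumpCost γ b (d - r) + η / 4 by simp; linarith))
    obtain ⟨ε, ⟨⟨h0, h1⟩, h2⟩, h3⟩ := (((h0.and h1).and h2).and h3).exists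
    exact ⟨ε, h0.1, h0.2, h1, h2, h3⟩
  set V := varC γ b
  -- changing the slope by `ε / V` gains `ε ^ 2 / (2 * V)` in the exponent, which must beat `2 * κ`
  set κ : ℝ := min (η / 4) (ε ^ 2 / (8 * V)) with hκ
  have hκ0 : 0 < κ := by positivity
  have hκη : κ ≤ η / 4 := min_le_left _ _
  have hκε : κ ≤ ε ^ 2 / (8 * V) := min_le_right _ _
  have evmgf := eventually_mgf_pow_bounds hγ0 hγ1 hb
    ({r / V, r / V + ε / V, r / V - ε / V} : Finset ℝ) hκ0
  have htT := (tendsto_add_atTop_iff_nat 1).2 (tendsto_natCast_rpow_one_sub_two_mul hγ0 hγ1)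
  have htl := (tendsto_add_atTop_iff_nat 1).2 (tendsto_natCast_rpow_one_sub hγ0 hγ1)
  have ev1 := (tendsto_add_atTop_nat 1).eventually
    (hN.eventually_abs_le (c := ε / 2) (by linarith))
  have ev2 := (htl.const_mul_atTop (show 0 < ε / 2 by linarith)).eventually_ge_atTop (rhoC γ b)
  have ev3 := (htT.atTop_mul_const (show 0 < ε ^ 2 / (4 * V) by positivity)).eventually_ge_atTop
    (Real.log 4)
  have ev4 := (htT.atTop_mul_const (show 0 < η / 4 by linarith)).eventually_ge_atTop
    (Real.log (2 * critZ γ b))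
  -- with `L + 1` sites in total, one carries the condensate and the other `L` are small
  suffices h : ∀ᶠ L : ℕ in atTop, critZ γ b ^ (L + 1) *
      Real.exp (-(((L + 1 : ℕ) : ℝ) ^ (1 - 2 * scaleExp γ) * (rateFunAux γ b d r + η)))
      ≤ partitionZ γ b (L + 1) (N (L + 1)) by
    obtain ⟨L0, hL0⟩ := eventually_atTop.1 h
    refine eventually_atTop.2 ⟨L0 + 1, fun L hL => ?_⟩
    have := hL0 (L - 1) (by omega)
    rwa [Nat.sub_add_cancel (by omega)] at this
  filter_upwards [evmgf, ev1, ev2, ev3, ev4] with L ⟨s, hs⟩ h1 h2 h3 h4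
  have hM0 : (0 : ℝ) < ((L + 1 : ℕ) : ℝ) := by positivity
  have ha : 0 < ((L + 1 : ℕ) : ℝ) ^ (-scaleExp γ) := by positivity
  have hl : 0 < ((L + 1 : ℕ) : ℝ) ^ (1 - scaleExp γ) := by positivity
  have hal := rpow_neg_scaleExp_mul (γ := γ) hM0
  have hlT := rpow_one_sub_scaleExp_rpow hγ0 hM0
  have hT : 0 < ((L + 1 : ℕ) : ℝ) ^ (1 - 2 * scaleExp γ) := by positivity
  have hML : ((L + 1 : ℕ) : ℝ) = L + 1 := by push_cast; ring
  set a := ((L + 1 : ℕ) : ℝ) ^ (-scaleExp γ)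
  set l := ((L + 1 : ℕ) : ℝ) ^ (1 - scaleExp γ)
  set T := ((L + 1 : ℕ) : ℝ) ^ (1 - 2 * scaleExp γ)
  set N' := N (L + 1)
  have hwnn : ∀ n, 0 ≤ weight γ b n := fun n => (weight_pos hb n).le
  set lo := (r - ε) * l with hlo
  set hi := (r + ε) * l with hhi
  have hwin := sum_window_ge hwnn s L (θ := r / V * a) (p := ε / V * a)
    (by positivity) (by positivity) (rhoC γ b) lo hi
  rw [← add_mul, ← sub_mul] at hwin
  set W := (Fintype.piFinset fun _ : Fin L => s).filter
          (fun ξ => lo ≤ (∑ x, (ξ x : ℝ)) - rhoC γ b * L ∧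
            (∑ x, (ξ x : ℝ)) - rhoC γ b * L ≤ hi) with hW
  have hN' := abs_le.1 h1
  have hWN : ∀ ξ ∈ W, ∑ x, ξ x ≤ N' := by
    intro ξ hξ
    have hξ' := (Finset.mem_filter.1 hξ).2.2
    have : (∑ x, (ξ x : ℝ)) ≤ N' := by
      rw [hML] at hN'
      have : (r + 2 * ε) * l ≤ d * l := by gcongr; linarith
      rw [hhi] at hξ'
      nlinarith [hN'.1, mul_pos hε0 hl]
    exact_mod_cast this
  have hjump : ∀ ξ ∈ W, Real.exp (-(T * (jumpCost γ b (d - r) + η / 4)))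
      ≤ weight γ b (N' - ∑ x, ξ x) := by
    intro ξ hξ
    refine le_trans (Real.exp_le_exp.2 (neg_le_neg ?_)) (exp_neg_jumpCost_le_weight hγ0 hγ1 hb _)
    have hξ' := (Finset.mem_filter.1 hξ).2.1
    have hle : ((N' - ∑ x, ξ x : ℕ) : ℝ) ≤ l * (d - r + 2 * ε) := by
      rw [Nat.cast_sub (hWN ξ hξ)]
      push_cast
      rw [hML] at hN'
      rw [hlo] at hξ'
      nlinarith [hN'.2]
    calc jumpCost γ b ((N' - ∑ x, ξ x : ℕ) : ℝ) ≤ jumpCost γ b (l * (d - r + 2 * ε)) :=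
          jumpCost_mono hγ1 hb (Nat.cast_nonneg _) hle
      _ = T * jumpCost γ b (d - r + 2 * ε) := by
          rw [jumpCost_mul hl.le (by linarith), hlT]
      _ ≤ T * (jumpCost γ b (d - r) + η / 4) := by gcongr
  have hmain : 1 / 2 * critZ γ b ^ L * Real.exp (T * ((r / V) ^ 2 * V / 2 - κ))
      * Real.exp (-(r / V * a * hi)) ≤ ∑ ξ ∈ W, ∏ x, weight γ b (ξ x) := by
    refine le_trans ?_ hwin
    rw [mul_comm]
    apply mul_le_mul_of_nonneg_left _ (Real.exp_nonneg _)
    have b0 := (hs (r / V) (by simp)).2 (by positivity)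
    have b1 := (hs (r / V + ε / V) (by simp)).1
    have b2 := (hs (r / V - ε / V) (by simp)).1
    have hsmall : Real.exp (-(T * (ε ^ 2 / (4 * V)))) ≤ 1 / 4 := by
      rw [Real.exp_neg]
      have : (4 : ℝ) ≤ Real.exp (T * (ε ^ 2 / (4 * V))) :=
        (Real.log_le_iff_le_exp (by norm_num)).1 h3
      rw [one_div]
      exact inv_anti₀ (by norm_num) this
    set E := Real.exp (T * ((r / V) ^ 2 * V / 2 - κ)) with hE
    have hgap : ∀ f : ℝ, f ≤ (r / V) ^ 2 * V / 2 - ε ^ 2 / (2 * V) + κ →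
        critZ γ b ^ L * Real.exp (T * f) ≤ 1 / 4 * (critZ γ b ^ L * E) := by
      intro f hf
      have : Real.exp (T * f) ≤ E * Real.exp (-(T * (ε ^ 2 / (4 * V)))) := by
        rw [hE, ← Real.exp_add]
        apply Real.exp_le_exp.2
        have e : ε ^ 2 / (2 * V) = ε ^ 2 / (4 * V) + 2 * (ε ^ 2 / (8 * V)) := by
          field_simp; norm_num
        have : f ≤ (r / V) ^ 2 * V / 2 - κ - ε ^ 2 / (4 * V) := by linarith
        calc T * f ≤ T * ((r / V) ^ 2 * V / 2 - κ - ε ^ 2 / (4 * V)) := by gcongr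
          _ = _ := by ring
      calc critZ γ b ^ L * Real.exp (T * f)
          ≤ critZ γ b ^ L * (E * Real.exp (-(T * (ε ^ 2 / (4 * V))))) := by gcongr
        _ ≤ critZ γ b ^ L * (E * (1 / 4)) := by gcongr
        _ = _ := by ring
    have t1 : Real.exp (-(ε / V * a * hi)) *
        (critZ γ b ^ L * Real.exp (T * ((r / V + ε / V) ^ 2 * V / 2 + κ)))
        ≤ 1 / 4 * (critZ γ b ^ L * E) := by
      refine le_trans (le_of_eq ?_) (hgap ((r / V) ^ 2 * V / 2 - ε ^ 2 / (2 * V) + κ) le_rfl)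
      rw [mul_left_comm, ← Real.exp_add]
      congr 2
      rw [hhi, show ε / V * a * ((r + ε) * l) = a * l * (ε / V * (r + ε)) by ring, hal]
      field_simp
      ring
    have t2 : Real.exp (ε / V * a * lo) *
        (critZ γ b ^ L * Real.exp (T * ((r / V - ε / V) ^ 2 * V / 2 + κ)))
        ≤ 1 / 4 * (critZ γ b ^ L * E) := by
      refine le_trans (le_of_eq ?_) (hgap ((r / V) ^ 2 * V / 2 - ε ^ 2 / (2 * V) + κ) le_rfl)
      rw [mul_left_comm, ← Real.exp_add]
      congr 2
      rw [hlo, show ε / V * a * ((r - ε) * l) = a * l * (ε / V * (r - ε)) by ring, hal]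
      field_simp
      ring
    have b1' := mul_le_mul_of_nonneg_left b1 (Real.exp_nonneg (-(ε / V * a * hi)))
    have b2' := mul_le_mul_of_nonneg_left b2 (Real.exp_nonneg (ε / V * a * lo))
    linarith
  have hlast := sum_le_confSum_succ hwnn W hWN
  rw [partitionZ_eq_confSum]
  refine le_trans ?_ hlast
  have hstep : Real.exp (-(T * (jumpCost γ b (d - r) + η / 4))) *
      ∑ ξ ∈ W, ∏ x, weight γ b (ξ x)
      ≤ ∑ ξ ∈ W, weight γ b (N' - ∑ x, ξ x) * ∏ x, weight γ b (ξ x) := by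
    rw [Finset.mul_sum]
    exact Finset.sum_le_sum fun ξ hξ => mul_le_mul_of_nonneg_right (hjump ξ hξ)
      (Finset.prod_nonneg fun x _ => hwnn _)
  refine le_trans ?_ ((mul_le_mul_of_nonneg_left hmain (Real.exp_nonneg _)).trans hstep)
  have hz2 : critZ γ b * Real.exp (-(T * (η / 4))) ≤ 1 / 2 := by
    have : 2 * critZ γ b ≤ Real.exp (T * (η / 4)) :=
      (Real.log_le_iff_le_exp (by positivity)).1 h4
    rw [Real.exp_neg, ← div_eq_mul_inv, div_le_iff₀ (Real.exp_pos _)]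
    linarith
  have hexp : Real.exp (-(T * (rateFunAux γ b d r + 3 * (η / 4))))
      ≤ Real.exp (-(T * (jumpCost γ b (d - r) + η / 4))) *
        (Real.exp (T * ((r / V) ^ 2 * V / 2 - κ)) * Real.exp (-(r / V * a * hi))) := by
    rw [← Real.exp_add, ← Real.exp_add]
    apply Real.exp_le_exp.2
    have h7 : rateFunAux γ b d r = r ^ 2 / (2 * V) + jumpCost γ b (d - r) := rfl
    have h8 : r / V * a * hi = T * (r ^ 2 / V + r * ε / V) := by
      rw [hhi, show r / V * a * ((r + ε) * l) = a * l * (r / V * (r + ε)) by ring, hal]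
      ring
    have h9 : (r / V) ^ 2 * V / 2 = r ^ 2 / (2 * V) := by field_simp
    have h10 : r ^ 2 / V = 2 * (r ^ 2 / (2 * V)) := by field_simp
    rw [h7, h8, h9, h10]
    have : T * (r * ε / V + κ) ≤ T * (η / 4 + η / 4) := by gcongr
    linarith
  calc critZ γ b ^ (L + 1) * Real.exp (-(T * (rateFunAux γ b d r + η)))
      = critZ γ b ^ L * (critZ γ b * Real.exp (-(T * (η / 4)))) *
        Real.exp (-(T * (rateFunAux γ b d r + 3 * (η / 4)))) := by
        rw [show -(T * (rateFunAux γ b d r + η))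
          = -(T * (η / 4)) + -(T * (rateFunAux γ b d r + 3 * (η / 4))) by ring, Real.exp_add]
        ring
    _ ≤ critZ γ b ^ L * (1 / 2) *
        (Real.exp (-(T * (jumpCost γ b (d - r) + η / 4))) *
        (Real.exp (T * ((r / V) ^ 2 * V / 2 - κ)) * Real.exp (-(r / V * a * hi)))) := by
        gcongr
    _ = _ := by ring

/-! ### From the rate function to the current -/

lemma continuous_rateFunAux (hγ1 : γ < 1) (d : ℝ) : Continuous (rateFunAux γ b d) := by
  have : rateFunAux γ b d = fun r => r ^ 2 / (2 * varC γ b) + jumpCost γ b (d - r) := rfl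
  rw [this]
  exact (by fun_prop : Continuous fun r : ℝ => r ^ 2 / (2 * varC γ b)).add
    ((continuous_jumpCost hγ1).comp (by fun_prop))

/-- Stability of the minimum under a small linear perturbation: to first order in `t`, the minimum
of `I r - t r / σ²` is attained at the unique minimiser of `I`. -/
lemma exists_forall_rateFunAux_sub_ge (hγ1 : γ < 1) (hV : 0 < varC γ b) {d rs : ℝ} (hd : 0 < d)
    (hrs : rs ∈ Set.Icc 0 d)
    (hmin : ∀ r ∈ Set.Icc 0 d, r ≠ rs → rateFunAux γ b d rs < rateFunAux γ b d r)
    {ε : ℝ} (hε : 0 < ε) : ∃ t₀ : ℝ, 0 < t₀ ∧ ∀ t : ℝ, |t| ≤ t₀ → ∀ r ∈ Set.Icc 0 d,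
      rateFunAux γ b d rs - t * rs / varC γ b - |t| * ε
        ≤ rateFunAux γ b d r - t * r / varC γ b := by
  set V := varC γ b
  set f := rateFunAux γ b d
  have hle : ∀ r ∈ Set.Icc 0 d, f rs ≤ f r := fun r hr => by
    by_cases h : r = rs
    · rw [h]
    · exact (hmin r hr h).le
  set S := Set.Icc 0 d ∩ {r : ℝ | ε * V ≤ |r - rs|} with hS
  have hScomp : IsCompact S := isCompact_Icc.inter_right
    (isClosed_le continuous_const (by fun_prop))
  obtain ⟨c, hc0, hc⟩ : ∃ c : ℝ, 0 < c ∧ ∀ r ∈ S, f rs + c ≤ f r := by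
    rcases S.eq_empty_or_nonempty with h | h
    · exact ⟨1, one_pos, fun r hr => by rw [h] at hr; exact hr.elim⟩
    · obtain ⟨r₁, hr₁, hmin₁⟩ :=
        hScomp.exists_isMinOn h (continuous_rateFunAux hγ1 d).continuousOn
      have hne : r₁ ≠ rs := by
        rintro rfl
        have := hr₁.2
        simp only [Set.mem_ofPred_eq, sub_self, abs_zero] at this
        nlinarith [mul_pos hε hV]
      exact ⟨f r₁ - f rs, sub_pos.2 (hmin r₁ hr₁.1 hne), fun r hr => by
        have : f r₁ ≤ f r := hmin₁ hr
        linarith⟩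
  refine ⟨c * V / d, by positivity, fun t ht r hr => ?_⟩
  have e : t * r / V = t * rs / V + t * (r - rs) / V := by ring
  have h1 : t * (r - rs) / V ≤ |t| * |r - rs| / V := by
    rw [← abs_mul]
    gcongr
    exact le_abs_self _
  have ht0 := abs_nonneg t
  by_cases h : ε * V ≤ |r - rs|
  · have h2 := hc r ⟨hr, h⟩
    have h3 : |r - rs| ≤ d := by
      rw [abs_le]
      constructor <;> linarith [hr.1, hr.2, hrs.1, hrs.2]
    have h4 : |t| * |r - rs| / V ≤ c := by
      calc |t| * |r - rs| / V ≤ c * V / d * d / V := by gcongr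
        _ = c := by field_simp
    have : 0 ≤ |t| * ε := by positivity
    linarith
  · have h4 : |t| * |r - rs| / V ≤ |t| * ε := by
      calc |t| * |r - rs| / V ≤ |t| * (ε * V) / V := by
            gcongr
            exact (not_le.1 h).le
        _ = |t| * ε := by field_simp
    linarith [hle r hr]

/-- The large-deviation bounds combined with Jensen's inequality. -/
lemma eventually_mul_current_le (hγ0 : 0 < γ) (hγ1 : γ < 1) (hb : 0 < b) {d rs : ℝ} (hd : 0 < d)
    (hrs : rs ∈ Set.Icc 0 d) {N : ℕ → ℕ} (hN : AtCriticalScale γ b d N) {t m : ℝ}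
    (hm : ∀ r ∈ Set.Icc 0 d, m ≤ rateFunAux γ b d r - t * r / varC γ b) {η : ℝ} (hη : 0 < η) :
    ∀ᶠ L : ℕ in atTop, t * ((L : ℝ) ^ scaleExp γ * (current γ b L (N L) - 1))
      ≤ rateFunAux γ b d rs - m + t ^ 2 * rateVar γ b / 2 + η := by
  have hz := critZ_pos hγ0 hγ1 hb
  have hρ := rhoC_pos hγ0 hγ1 hb
  obtain ⟨r, hr, hrη⟩ : ∃ r ∈ Set.Ioo 0 d, rateFunAux γ b d r < rateFunAux γ b d rs + η / 3 := by
    have hcl : rs ∈ closure (Set.Ioo 0 d) := by rwa [closure_Ioo hd.ne]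
    obtain ⟨r, h1, h2⟩ := mem_closure_iff.1 hcl
      {r | rateFunAux γ b d r < rateFunAux γ b d rs + η / 3}
      (isOpen_lt (continuous_rateFunAux hγ1 d) continuous_const)
      (by simp only [Set.mem_ofPred_eq]; linarith)
    exact ⟨r, h2, h1⟩
  filter_upwards [eventually_confSum_tilted_le hγ0 hγ1 hb hd hN hm (show 0 < η / 3 by linarith),
    eventually_le_partitionZ hγ0 hγ1 hb hN hr (show 0 < η / 3 by linarith),
    hN.eventually_abs_le hd, eventually_ge_atTop 1] with L hup hlow hNL hL
  have hL0 : (0 : ℝ) < L := by exact_mod_cast hL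
  have hN1 : 1 ≤ N L := by
    have h1 := (abs_le.1 hNL).1
    have h2 : (0 : ℝ) < N L := by nlinarith [mul_pos hρ hL0]
    exact_mod_cast h2
  have hZ : 0 < partitionZ γ b L (N L) := lt_of_lt_of_le (by positivity) hlow
  have hT : 0 < (L : ℝ) ^ (1 - 2 * scaleExp γ) := by positivity
  have hj := exp_current_mul_partitionZ_le hb hN1 hZ (t * (L : ℝ) ^ (-scaleExp γ))
  set X := (L : ℝ) ^ scaleExp γ * (current γ b L (N L) - 1) with hX
  have e : t * (L : ℝ) ^ (-scaleExp γ) * (L * (current γ b L (N L) - 1))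
      = (L : ℝ) ^ (1 - 2 * scaleExp γ) * (t * X) := by
    have h1 : (L : ℝ) ^ (1 - 2 * scaleExp γ) * (L : ℝ) ^ scaleExp γ
        = (L : ℝ) ^ (-scaleExp γ) * L := by
      rw [← Real.rpow_add hL0]
      nth_rewrite 3 [← Real.rpow_one (L : ℝ)]
      rw [← Real.rpow_add hL0]
      congr 1
      ring
    rw [hX]
    linear_combination (-t * (current γ b L (N L) - 1)) * h1
  rw [e] at hj
  set T := (L : ℝ) ^ (1 - 2 * scaleExp γ)
  have hchain : critZ γ b ^ L * Real.exp (T * (t * X) + -(T * (rateFunAux γ b d r + η / 3)))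
      ≤ critZ γ b ^ L * Real.exp (T * (-m + t ^ 2 * rateVar γ b / 2 + η / 3)) := by
    refine le_trans ?_ (hj.trans hup)
    rw [Real.exp_add, mul_left_comm]
    exact mul_le_mul_of_nonneg_left hlow (Real.exp_nonneg _)
  have h2 := Real.exp_le_exp.1 (le_of_mul_le_mul_left hchain (by positivity))
  have h3 : T * (t * X) ≤ T * (rateFunAux γ b d r + η / 3
      + (-m + t ^ 2 * rateVar γ b / 2 + η / 3)) := by linarith
  have h4 := le_of_mul_le_mul_left h3 hT
  linarith

/-- If the rate function has a unique minimiser `rs` on `[0, d]`, then the rescaled current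
overshoot converges to `rs / σ²`. -/
lemma tendsto_current (hγ0 : 0 < γ) (hγ1 : γ < 1) (hb : 0 < b) {d rs : ℝ} (hd : 0 < d)
    (hrs : rs ∈ Set.Icc 0 d)
    (hmin : ∀ r ∈ Set.Icc 0 d, r ≠ rs → rateFunAux γ b d rs < rateFunAux γ b d r)
    {N : ℕ → ℕ} (hN : AtCriticalScale γ b d N) :
    Tendsto (fun L : ℕ => (L : ℝ) ^ scaleExp γ * (current γ b L (N L) - 1)) atTop
      (𝓝 (rs / varC γ b)) := by
  have hV := varC_pos hγ0 hγ1 hb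
  rw [Metric.tendsto_nhds]
  intro e he
  set ε := e / 4 with hε
  have hε0 : 0 < ε := by positivity
  obtain ⟨t₀, ht₀, hstab⟩ := exists_forall_rateFunAux_sub_ge hγ1 hV hd hrs hmin hε0
  obtain ⟨t, ht, htt₀, htv⟩ : ∃ t : ℝ, 0 < t ∧ t ≤ t₀ ∧ t * rateVar γ b / 2 ≤ ε := by
    have hv : (0 : ℝ) < |rateVar γ b| + 1 := by positivity
    refine ⟨min t₀ (ε / (|rateVar γ b| + 1)), by positivity, min_le_left _ _, ?_⟩
    set t := min t₀ (ε / (|rateVar γ b| + 1)) with htdef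
    have ht : 0 < t := by positivity
    have h1 : t ≤ ε / (|rateVar γ b| + 1) := min_le_right _ _
    rw [le_div_iff₀ hv] at h1
    nlinarith [le_abs_self (rateVar γ b), abs_nonneg (rateVar γ b),
      mul_le_mul_of_nonneg_left (le_abs_self (rateVar γ b)) ht.le,
      mul_nonneg ht.le (abs_nonneg (rateVar γ b))]
  have hη : 0 < t * ε := by positivity
  -- the two signs of the tilt give the upper and the lower bound
  have hup := eventually_mul_current_le hγ0 hγ1 hb hd hrs hN
    (hstab t (by rwa [abs_of_pos ht])) hη
  have hlow := eventually_mul_current_le hγ0 hγ1 hb hd hrs hN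
    (hstab (-t) (by rwa [abs_neg, abs_of_pos ht])) hη
  filter_upwards [hup, hlow] with L h1 h2
  set X := (L : ℝ) ^ scaleExp γ * (current γ b L (N L) - 1)
  rw [abs_of_pos ht] at h1
  rw [abs_neg, abs_of_pos ht] at h2
  have htv' : t ^ 2 * rateVar γ b / 2 ≤ t * ε := by
    calc t ^ 2 * rateVar γ b / 2 = t * (t * rateVar γ b / 2) := by ring
      _ ≤ t * ε := by gcongr
  have h3 : t * (X - rs / varC γ b) ≤ t * (3 * ε) := by
    have : t * rs / varC γ b = t * (rs / varC γ b) := by ring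
    nlinarith
  have h4 : t * (rs / varC γ b - X) ≤ t * (3 * ε) := by
    have : -t * rs / varC γ b = -(t * (rs / varC γ b)) := by ring
    rw [neg_sq] at h2
    nlinarith
  have h5 := le_of_mul_le_mul_left h3 ht
  have h6 := le_of_mul_le_mul_left h4 ht
  rw [Real.dist_eq, abs_lt]
  constructor <;> linarith

lemma isLittleO_of_tendsto_current {N : ℕ → ℕ} {J : ℝ}
    (h : Tendsto (fun L : ℕ => (L : ℝ) ^ scaleExp γ * (current γ b L (N L) - 1)) atTop (𝓝 J)) :
    (fun L : ℕ => current γ b L (N L) - 1 - (L : ℝ) ^ (-scaleExp γ) * J)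
      =o[atTop] fun L : ℕ => (L : ℝ) ^ (-scaleExp γ) := by
  have hpos : ∀ᶠ L : ℕ in atTop, (0 : ℝ) < L := by
    filter_upwards [eventually_gt_atTop 0] with L hL
    exact_mod_cast hL
  rw [isLittleO_iff_tendsto']
  · have h' := h.sub_const J
    rw [sub_self] at h'
    refine h'.congr' ?_
    filter_upwards [hpos] with L hL
    have h1 : (L : ℝ) ^ scaleExp γ ≠ 0 := (Real.rpow_pos_of_pos hL _).ne'
    rw [Real.rpow_neg hL.le]
    field_simp
  · filter_upwards [hpos] with L hL h0
    exact absurd h0 (Real.rpow_pos_of_pos hL _).ne'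

/-! ### Minimisers of the rate function -/

/-- The rescaled size of the condensate at the transition point: the minimiser of
`y / (2 σ²) + b / (1 - γ) * y ^ (-γ)`. -/
noncomputable def transSize (γ b : ℝ) : ℝ := 2 * γ / (1 + γ) * dTrans γ b

lemma dTrans_pos (hγ0 : 0 < γ) (hγ1 : γ < 1) (hb : 0 < b) : 0 < dTrans γ b := by
  have hV := varC_pos hγ0 hγ1 hb
  have h1 : (0 : ℝ) < 1 - γ := by linarith
  rw [dTrans]
  positivity

lemma transSize_pos (hγ0 : 0 < γ) (hγ1 : γ < 1) (hb : 0 < b) : 0 < transSize γ b := by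
  have := dTrans_pos hγ0 hγ1 hb
  rw [transSize]
  positivity

lemma transSize_lt_dTrans (hγ0 : 0 < γ) (hγ1 : γ < 1) (hb : 0 < b) :
    transSize γ b < dTrans γ b := by
  have := dTrans_pos hγ0 hγ1 hb
  rw [transSize]
  have h : 2 * γ / (1 + γ) < 1 := by rw [div_lt_one (by linarith)]; linarith
  nlinarith

lemma mul_transSize_rpow_neg (hγ0 : 0 < γ) (hγ1 : γ < 1) (hb : 0 < b) :
    b / (1 - γ) * transSize γ b ^ (-γ) = transSize γ b / (2 * γ * varC γ b) := by
  have hV := varC_pos hγ0 hγ1 hb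
  have h1 : (0 : ℝ) < 1 - γ := by linarith
  have h2 : (0 : ℝ) < 1 + γ := by linarith
  have hB : 0 < b / (1 - γ) := by positivity
  have hy := transSize_pos hγ0 hγ1 hb
  have e1 : transSize γ b = (varC γ b * (2 * γ) * (b / (1 - γ))) ^ (1 / (1 + γ)) := by
    rw [Real.mul_rpow (by positivity) hB.le, Real.mul_rpow hV.le (by positivity), transSize, dTrans]
    have e2 : (2 * γ) ^ (1 / (1 + γ)) = 2 * γ * (2 * γ) ^ (-(γ / (1 + γ))) := by
      nth_rewrite 2 [← Real.rpow_one (2 * γ)]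
      rw [← Real.rpow_add (by positivity)]
      congr 1
      field_simp
      ring
    rw [e2]
    field_simp
  have e3 : transSize γ b ^ (1 + γ) = varC γ b * (2 * γ) * (b / (1 - γ)) := by
    rw [e1, ← Real.rpow_mul (by positivity), one_div, inv_mul_cancel₀ h2.ne', Real.rpow_one]
  have e4 : transSize γ b ^ (-γ) * transSize γ b ^ (1 + γ) = transSize γ b := by
    rw [← Real.rpow_add hy]
    simp
  rw [e3] at e4
  rw [eq_div_iff (by positivity)]
  linarith

/-- The convex function `u ^ (-γ)` lies above its tangent at `1`. -/
lemma tangent_le_rpow_neg (hγ0 : 0 < γ) {u : ℝ} (hu : 0 < u) : 1 - γ * (u - 1) ≤ u ^ (-γ) := by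
  rw [Real.rpow_def_of_pos hu]
  have h1 := Real.add_one_le_exp (Real.log u * -γ)
  have h2 := Real.log_le_sub_one_of_pos hu
  nlinarith

lemma tangent_lt_rpow_neg (hγ0 : 0 < γ) {u : ℝ} (hu : 0 < u) (hu1 : u ≠ 1) :
    1 - γ * (u - 1) < u ^ (-γ) := by
  rw [Real.rpow_def_of_pos hu]
  have h1 := Real.add_one_le_exp (Real.log u * -γ)
  have h2 := Real.log_lt_sub_one_of_pos hu hu1
  nlinarith

lemma rpow_neg_eq_mul {x y : ℝ} (hx : 0 < x) (hy : 0 < y) :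
    y ^ (-γ) = x ^ (-γ) * (y / x) ^ (-γ) := by
  rw [← Real.mul_rpow hx.le (by positivity), mul_div_cancel₀ _ hx.ne']

lemma dTrans_div_le (hγ0 : 0 < γ) (hγ1 : γ < 1) (hb : 0 < b) {y : ℝ} (hy : 0 < y) :
    dTrans γ b / varC γ b ≤ y / (2 * varC γ b) + b / (1 - γ) * y ^ (-γ) := by
  have hV := varC_pos hγ0 hγ1 hb
  have hx := transSize_pos hγ0 hγ1 hb
  set x := transSize γ b with hxdef
  have e : dTrans γ b = (1 + γ) / (2 * γ) * x := by rw [hxdef, transSize]; field_simp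
  have h := tangent_le_rpow_neg hγ0 (show 0 < y / x by positivity)
  rw [rpow_neg_eq_mul hx hy, ← mul_assoc, hxdef, mul_transSize_rpow_neg hγ0 hγ1 hb, ← hxdef, e]
  have h2 : x / (2 * γ * varC γ b) * (1 - γ * (y / x - 1))
      ≤ x / (2 * γ * varC γ b) * (y / x) ^ (-γ) := mul_le_mul_of_nonneg_left h (by positivity)
  refine le_trans (le_of_eq ?_) (add_le_add le_rfl h2)
  field_simp
  ring

lemma dTrans_div_eq (hγ0 : 0 < γ) (hγ1 : γ < 1) (hb : 0 < b) :
    transSize γ b / (2 * varC γ b) + b / (1 - γ) * transSize γ b ^ (-γ)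
      = dTrans γ b / varC γ b := by
  have hV := varC_pos hγ0 hγ1 hb
  rw [mul_transSize_rpow_neg hγ0 hγ1 hb, transSize]
  field_simp
  ring

lemma rateFunAux_self (hγ1 : γ < 1) (d : ℝ) : rateFunAux γ b d d = d ^ 2 / (2 * varC γ b) := by
  rw [rateFunAux, sub_self, Real.zero_rpow (by linarith), mul_zero, add_zero]

/-- The rate function in terms of the condensate size `y = d - r`. Comparing the bracket with `0`
decides between the fluid and the condensed phase. -/
lemma rateFunAux_sub (hγ0 : 0 < γ) (hγ1 : γ < 1) (hb : 0 < b) (d : ℝ) {y : ℝ} (hy : 0 < y) :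
    rateFunAux γ b d (d - y) = d ^ 2 / (2 * varC γ b)
      + y * (y / (2 * varC γ b) + b / (1 - γ) * y ^ (-γ) - d / varC γ b) := by
  have hV := varC_pos hγ0 hγ1 hb
  have e : y ^ (1 - γ) = y * y ^ (-γ) := by
    rw [sub_eq_add_neg, Real.rpow_add hy, Real.rpow_one]
  rw [rateFunAux, sub_sub_cancel, e]
  field_simp
  ring

lemma rateFunAux_lt_of_lt_dTrans (hγ0 : 0 < γ) (hγ1 : γ < 1) (hb : 0 < b) {d : ℝ}
    (hd : d < dTrans γ b) {r : ℝ} (hr : r ∈ Set.Icc 0 d) (hrd : r ≠ d) :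
    rateFunAux γ b d d < rateFunAux γ b d r := by
  have hV := varC_pos hγ0 hγ1 hb
  have hy : 0 < d - r := sub_pos.2 (lt_of_le_of_ne hr.2 hrd)
  have e := rateFunAux_sub hγ0 hγ1 hb d hy
  rw [sub_sub_cancel] at e
  rw [e, rateFunAux_self hγ1]
  have h1 := dTrans_div_le hγ0 hγ1 hb hy
  have h2 : d / varC γ b < dTrans γ b / varC γ b := by gcongr
  have := mul_pos hy (show 0 < (d - r) / (2 * varC γ b) + b / (1 - γ) * (d - r) ^ (-γ)
    - d / varC γ b by linarith)
  linarith

lemma hasDerivAt_rateFunAux (hγ1 : γ < 1) {d r : ℝ} (hr : r < d) :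
    HasDerivAt (rateFunAux γ b d) (r / varC γ b - b * (d - r) ^ (-γ)) r := by
  have h1 : HasDerivAt (fun r : ℝ => r ^ 2 / (2 * varC γ b)) (2 * r / (2 * varC γ b)) r := by
    simpa using (hasDerivAt_pow 2 r).div_const (2 * varC γ b)
  have h2 : HasDerivAt (fun r : ℝ => d - r) (-1) r := by
    simpa using (hasDerivAt_id r).const_sub d
  have h3 := (h2.rpow_const (p := 1 - γ) (Or.inl (sub_pos.2 hr).ne')).const_mul (b / (1 - γ))
  have h4 := h1.add h3
  have h5 : (1 : ℝ) - γ ≠ 0 := by linarith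
  have e : 2 * r / (2 * varC γ b) + b / (1 - γ) * (-1 * (1 - γ) * (d - r) ^ (1 - γ - 1))
      = r / varC γ b - b * (d - r) ^ (-γ) := by
    rw [show 1 - γ - 1 = -γ by ring, mul_div_mul_left _ _ two_ne_zero]
    field_simp
    ring
  rw [e] at h4
  exact h4

lemma critical_point_eq (hγ0 : 0 < γ) (hγ1 : γ < 1) (hb : 0 < b) {d r : ℝ} (hr : r < d)
    (h : IsLocalMin (rateFunAux γ b d) r) : r = varC γ b * b * (d - r) ^ (-γ) := by
  have hV := varC_pos hγ0 hγ1 hb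
  have := h.hasDerivAt_eq_zero (hasDerivAt_rateFunAux hγ1 hr)
  rw [sub_eq_zero, div_eq_iff hV.ne'] at this
  linarith

/-- There is at most one local minimum in the open interval. The derivative is strictly concave, so
beyond the second of two critical points it is negative. -/
lemma not_lt_of_isLocalMin (hγ0 : 0 < γ) (hγ1 : γ < 1) (hb : 0 < b) {d r₁ r₂ : ℝ}
    (hr₁ : r₁ ∈ Set.Ioo 0 d) (hr₂ : r₂ ∈ Set.Ioo 0 d) (h₁ : IsLocalMin (rateFunAux γ b d) r₁)
    (h₂ : IsLocalMin (rateFunAux γ b d) r₂) : ¬ r₁ < r₂ := by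
  intro hlt
  have hV := varC_pos hγ0 hγ1 hb
  have c1 := critical_point_eq hγ0 hγ1 hb hr₁.2 h₁
  have c2 := critical_point_eq hγ0 hγ1 hb hr₂.2 h₂
  have hy1 : 0 < d - r₁ := sub_pos.2 hr₁.2
  have hy2 : 0 < d - r₂ := sub_pos.2 hr₂.2
  rw [rpow_neg_eq_mul hy2 hy1, ← mul_assoc, ← c2] at c1
  -- the tangent at `d - r₂` of the convex function `y ^ (-γ)` decides the sign on both sides
  have hslope : d - r₂ < r₂ * γ := by
    have h := tangent_lt_rpow_neg hγ0 (u := (d - r₁) / (d - r₂)) (by positivity)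
      (by rw [Ne, div_eq_one_iff_eq hy2.ne']; intro h; linarith)
    have h' := mul_lt_mul_of_pos_left h hr₂.1
    rw [← c1] at h'
    have e : (d - r₁) / (d - r₂) - 1 = (r₂ - r₁) / (d - r₂) := by field_simp; ring
    rw [e] at h'
    have h3 : r₂ - r₁ < r₂ * γ * ((r₂ - r₁) / (d - r₂)) := by linarith
    rw [mul_div_assoc', lt_div_iff₀ hy2] at h3
    nlinarith
  have hneg : ∀ r, r₂ < r → r < d → r / varC γ b - b * (d - r) ^ (-γ) < 0 := by
    intro r h1 h2
    have hy : 0 < d - r := sub_pos.2 h2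
    have h := tangent_le_rpow_neg hγ0 (u := (d - r) / (d - r₂)) (by positivity)
    have h' := mul_le_mul_of_nonneg_left h hr₂.1.le
    have e : (d - r) / (d - r₂) - 1 = -((r - r₂) / (d - r₂)) := by field_simp; ring
    have e2 : varC γ b * b * (d - r) ^ (-γ) = r₂ * ((d - r) / (d - r₂)) ^ (-γ) := by
      rw [rpow_neg_eq_mul hy2 hy, ← mul_assoc, ← c2]
    rw [e] at h'
    have h3 : r - r₂ < r₂ * γ * ((r - r₂) / (d - r₂)) := by
      rw [mul_div_assoc', lt_div_iff₀ hy2]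
      nlinarith
    rw [sub_neg, div_lt_iff₀ hV]
    nlinarith
  have hanti : StrictAntiOn (rateFunAux γ b d) (Set.Ico r₂ d) := by
    refine strictAntiOn_of_deriv_neg (convex_Ico r₂ d)
      (continuous_rateFunAux hγ1 d).continuousOn fun r hr => ?_
    rw [interior_Ico] at hr
    rw [(hasDerivAt_rateFunAux hγ1 hr.2).deriv]
    exact hneg r hr.1 hr.2
  have hev : ∀ᶠ r in 𝓝[>] r₂, rateFunAux γ b d r₂ ≤ rateFunAux γ b d r :=
    h₂.filter_mono nhdsWithin_le_nhds
  have hIoo : ∀ᶠ r in 𝓝[>] r₂, r ∈ Set.Ioo r₂ d := Ioo_mem_nhdsGT hr₂.2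
  obtain ⟨r, hr, hr'⟩ := (hev.and hIoo).exists
  exact absurd (hanti ⟨le_rfl, hr₂.2⟩ ⟨hr'.1.le, hr'.2⟩ hr'.1) (not_lt.2 hr)

lemma isLocalMin_rateFun_iff {d r : ℝ} :
    IsLocalMin (rateFun γ b d) r ↔ IsLocalMin (rateFunAux γ b d) r := by
  simp only [IsLocalMin, IsMinFilter, rateFun, sub_le_sub_iff_right]

lemma exists_rateFunAux_lt_zero (hγ0 : 0 < γ) (hγ1 : γ < 1) (hb : 0 < b) {d : ℝ} (hd : 0 < d) :
    ∃ r ∈ Set.Icc 0 d, rateFunAux γ b d r < rateFunAux γ b d 0 := by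
  have hV := varC_pos hγ0 hγ1 hb
  have hk : 0 < b / d ^ γ := by positivity
  set r := min d (varC γ b * (b / d ^ γ)) with hr
  have hr0 : 0 < r := by positivity
  refine ⟨r, ⟨hr0.le, min_le_left _ _⟩, ?_⟩
  have h1 := jumpCost_le_tangent hγ0 hγ1 hb hd (show 0 ≤ d - r from sub_nonneg.2 (min_le_left _ _))
  have e1 : rateFunAux γ b d r = r ^ 2 / (2 * varC γ b) + jumpCost γ b (d - r) := rfl
  have e0 : rateFunAux γ b d 0 = jumpCost γ b d := by simp [rateFunAux, jumpCost]
  have h2 : r ^ 2 / (2 * varC γ b) < b / d ^ γ * r := by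
    rw [div_lt_iff₀ (by positivity)]
    have h3 : r ≤ varC γ b * (b / d ^ γ) := min_le_right _ _
    have h4 : 0 < varC γ b * (b / d ^ γ) := by positivity
    nlinarith
  rw [e1, e0]
  linarith

/-- Above the transition point the rate function has a unique global minimiser on `[0, d]`; it lies
in the open interval and is the only local minimum there. -/
lemma exists_condensedMin (hγ0 : 0 < γ) (hγ1 : γ < 1) (hb : 0 < b) {d : ℝ} (hd : dTrans γ b < d) :
    ∃ r₀ : ℝ, IsCondensedMin γ b d r₀ ∧ (∀ r, IsCondensedMin γ b d r → r = r₀) ∧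
      ∀ r ∈ Set.Icc 0 d, r ≠ r₀ → rateFunAux γ b d r₀ < rateFunAux γ b d r := by
  have hV := varC_pos hγ0 hγ1 hb
  have hdT := dTrans_pos hγ0 hγ1 hb
  have hd0 : 0 < d := hdT.trans hd
  have hx := transSize_pos hγ0 hγ1 hb
  have hxd := (transSize_lt_dTrans hγ0 hγ1 hb).trans hd
  have hlt_d : rateFunAux γ b d (d - transSize γ b) < rateFunAux γ b d d := by
    rw [rateFunAux_sub hγ0 hγ1 hb d hx, rateFunAux_self hγ1, dTrans_div_eq hγ0 hγ1 hb]
    have h2 : dTrans γ b / varC γ b < d / varC γ b := by gcongr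
    nlinarith
  obtain ⟨r', hr', hlt_0⟩ := exists_rateFunAux_lt_zero hγ0 hγ1 hb hd0
  have hint : ∀ r ∈ Set.Icc 0 d, (∀ s ∈ Set.Icc 0 d, rateFunAux γ b d r ≤ rateFunAux γ b d s) →
      IsCondensedMin γ b d r := by
    intro r hr hmin
    have h0 : r ≠ 0 := by
      rintro rfl
      exact absurd hlt_0 (not_lt.2 (hmin r' hr'))
    have h1 : r ≠ d := by
      rintro rfl
      exact absurd hlt_d (not_lt.2 (hmin _ ⟨by linarith, by linarith⟩))
    have hIoo : r ∈ Set.Ioo 0 d := ⟨lt_of_le_of_ne hr.1 h0.symm, lt_of_le_of_ne hr.2 h1⟩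
    refine ⟨hIoo, isLocalMin_rateFun_iff.2 ?_⟩
    exact IsMinOn.isLocalMin (s := Set.Icc 0 d) (fun s hs => hmin s hs)
      (Icc_mem_nhds hIoo.1 hIoo.2)
  have huniq : ∀ r s, IsCondensedMin γ b d r → IsCondensedMin γ b d s → r = s := by
    intro r s hr hs
    have h1 := isLocalMin_rateFun_iff.1 hr.2
    have h2 := isLocalMin_rateFun_iff.1 hs.2
    exact le_antisymm (not_lt.1 (not_lt_of_isLocalMin hγ0 hγ1 hb hs.1 hr.1 h2 h1))
      (not_lt.1 (not_lt_of_isLocalMin hγ0 hγ1 hb hr.1 hs.1 h1 h2))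
  obtain ⟨r₀, hr₀, hmin⟩ := isCompact_Icc.exists_isMinOn (Set.nonempty_Icc.2 hd0.le)
    (continuous_rateFunAux (b := b) hγ1 d).continuousOn
  have hc := hint r₀ hr₀ fun s hs => hmin hs
  refine ⟨r₀, hc, fun r hr => huniq r r₀ hr hc, fun r hr hne => ?_⟩
  have hle : rateFunAux γ b d r₀ ≤ rateFunAux γ b d r := hmin hr
  refine lt_of_le_of_ne hle fun heq => hne (huniq r r₀ (hint r hr fun s hs => ?_) hc)
  rw [← heq]
  exact hmin hs

lemma condensedMin_div_varC (hγ0 : 0 < γ) (hγ1 : γ < 1) (hb : 0 < b) {d r₀ : ℝ}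
    (h : IsCondensedMin γ b d r₀) : r₀ / varC γ b = b / (d - r₀) ^ γ := by
  have hV := varC_pos hγ0 hγ1 hb
  have hy : 0 < d - r₀ := sub_pos.2 h.1.2
  have := critical_point_eq hγ0 hγ1 hb h.1.2 (isLocalMin_rateFun_iff.1 h.2)
  rw [Real.rpow_neg hy.le] at this
  rw [div_eq_iff hV.ne']
  conv_lhs => rw [this]
  field_simp

/-- Just above the transition point the condensate size `d - r₀` exceeds `transSize` by at most a
multiple of `d - dTrans`. -/
lemma condensate_size_bounds (hγ0 : 0 < γ) (hγ1 : γ < 1) (hb : 0 < b) {d r₀ : ℝ}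
    (hd : dTrans γ b < d) (h : IsCondensedMin γ b d r₀)
    (hmin : ∀ r ∈ Set.Icc 0 d, r ≠ r₀ → rateFunAux γ b d r₀ < rateFunAux γ b d r) :
    transSize γ b ≤ d - r₀ ∧
      d - r₀ - transSize γ b ≤ 2 / (1 + γ) * (d - dTrans γ b) := by
  have hV := varC_pos hγ0 hγ1 hb
  have hx := transSize_pos hγ0 hγ1 hb
  have hxd := (transSize_lt_dTrans hγ0 hγ1 hb).trans hd
  have hy : 0 < d - r₀ := sub_pos.2 h.1.2
  -- compare the minimiser for `d` with `transSize`, which is optimal at the transition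
  have hlow : transSize γ b ≤ d - r₀ := by
    have hle : rateFunAux γ b d (d - (d - r₀)) ≤ rateFunAux γ b d (d - transSize γ b) := by
      rw [sub_sub_cancel]
      by_cases he : d - transSize γ b = r₀
      · rw [he]
      · exact (hmin _ ⟨by linarith, by linarith⟩ he).le
    rw [rateFunAux_sub hγ0 hγ1 hb d hx, rateFunAux_sub hγ0 hγ1 hb d hy,
      dTrans_div_eq hγ0 hγ1 hb] at hle
    have h1 := mul_le_mul_of_nonneg_left (dTrans_div_le hγ0 hγ1 hb hy) hy.le
    have h2 : (d - r₀) * (dTrans γ b / varC γ b - d / varC γ b)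
        ≤ transSize γ b * (dTrans γ b / varC γ b - d / varC γ b) := by linarith
    have h3 : dTrans γ b / varC γ b - d / varC γ b < 0 := by
      have : dTrans γ b / varC γ b < d / varC γ b := by gcongr
      linarith
    exact (mul_le_mul_right_of_neg h3).1 h2
  refine ⟨hlow, ?_⟩
  have hc := critical_point_eq hγ0 hγ1 hb h.1.2 (isLocalMin_rateFun_iff.1 h.2)
  have ht := tangent_le_rpow_neg hγ0 (u := (d - r₀) / transSize γ b) (by positivity)
  have h1γ : (0 : ℝ) < 1 - γ := by linarith
  have ek : varC γ b * b * transSize γ b ^ (-γ) = (1 - γ) / (2 * γ) * transSize γ b := by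
    have := mul_transSize_rpow_neg hγ0 hγ1 hb
    have e : varC γ b * b * transSize γ b ^ (-γ)
        = varC γ b * (1 - γ) * (b / (1 - γ) * transSize γ b ^ (-γ)) := by field_simp
    rw [e, this]
    field_simp
  rw [rpow_neg_eq_mul hx hy, ← mul_assoc, ek] at hc
  have e : dTrans γ b = (1 + γ) / (2 * γ) * transSize γ b := by rw [transSize]; field_simp
  have h2 : (1 - γ) / (2 * γ) * transSize γ b * (1 - γ * ((d - r₀) / transSize γ b - 1)) ≤ r₀ := by
    conv_rhs => rw [hc]
    exact mul_le_mul_of_nonneg_left ht (by positivity)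
  have e2 : (1 - γ) / (2 * γ) * transSize γ b * (1 - γ * ((d - r₀) / transSize γ b - 1))
      = dTrans γ b - transSize γ b - (1 - γ) / 2 * (d - r₀ - transSize γ b) := by
    rw [e]
    field_simp
    ring
  rw [e2] at h2
  rw [div_mul_eq_mul_div, le_div_iff₀ (by linarith)]
  linarith

end ZeroRange

theorem mainTheorem2 (γ b : ℝ) (hγ0 : 0 < γ) (hγ1 : γ < 1) (hb : 0 < b) :
    -- fluid regime
    (∀ d : ℝ, 0 < d → d < ZeroRange.dTrans γ b →
      ∀ N : ℕ → ℕ, ZeroRange.AtCriticalScale γ b d N →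
        (fun L : ℕ => ZeroRange.current γ b L (N L) - 1
            - (L : ℝ) ^ (-ZeroRange.scaleExp γ) * (d / ZeroRange.varC γ b))
          =o[atTop] (fun L : ℕ => (L : ℝ) ^ (-ZeroRange.scaleExp γ))) ∧
    -- condensed regime
    (∀ d : ℝ, ZeroRange.dTrans γ b < d →
      ∃ r₀ : ℝ, ZeroRange.IsCondensedMin γ b d r₀ ∧
        (∀ r : ℝ, ZeroRange.IsCondensedMin γ b d r → r = r₀) ∧
        ∀ N : ℕ → ℕ, ZeroRange.AtCriticalScale γ b d N →
          (fun L : ℕ => ZeroRange.current γ b L (N L) - 1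
              - b * (L : ℝ) ^ (-ZeroRange.scaleExp γ) / (d - r₀) ^ γ)
            =o[atTop] (fun L : ℕ => (L : ℝ) ^ (-ZeroRange.scaleExp γ))) ∧
    -- the limiting rescaled current overshoot jumps down at the transition point
    (∃ J : ℝ → ℝ,
      (∀ d : ℝ, 0 < d → d ≠ ZeroRange.dTrans γ b →
        ∀ N : ℕ → ℕ, ZeroRange.AtCriticalScale γ b d N →
          Tendsto (fun L : ℕ => (L : ℝ) ^ ZeroRange.scaleExp γ
            * (ZeroRange.current γ b L (N L) - 1)) atTop (𝓝 (J d))) ∧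
      ∃ jl jr : ℝ, jr < jl ∧
        Tendsto J (𝓝[<] (ZeroRange.dTrans γ b)) (𝓝 jl) ∧
        Tendsto J (𝓝[>] (ZeroRange.dTrans γ b)) (𝓝 jr)) := by
  open ZeroRange in
  have hV := varC_pos hγ0 hγ1 hb
  have hdT := dTrans_pos hγ0 hγ1 hb
  have hfluid : ∀ d : ℝ, 0 < d → d < dTrans γ b → ∀ N : ℕ → ℕ, AtCriticalScale γ b d N →
      Tendsto (fun L : ℕ => (L : ℝ) ^ scaleExp γ * (current γ b L (N L) - 1)) atTop
        (𝓝 (d / varC γ b)) := fun d hd0 hd N hN =>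
    tendsto_current hγ0 hγ1 hb hd0 ⟨hd0.le, le_rfl⟩
      (fun r hr hne => rateFunAux_lt_of_lt_dTrans hγ0 hγ1 hb hd hr hne) hN
  choose! r₀ hr₀ huniq hmin using fun (d : ℝ) (hd : dTrans γ b < d) =>
    exists_condensedMin hγ0 hγ1 hb hd
  have hcond : ∀ d : ℝ, dTrans γ b < d → ∀ N : ℕ → ℕ, AtCriticalScale γ b d N →
      Tendsto (fun L : ℕ => (L : ℝ) ^ scaleExp γ * (current γ b L (N L) - 1)) atTop
        (𝓝 (r₀ d / varC γ b)) := fun d hd N hN =>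
    tendsto_current hγ0 hγ1 hb (hdT.trans hd) ⟨(hr₀ d hd).1.1.le, (hr₀ d hd).1.2.le⟩
      (hmin d hd) hN
  refine ⟨fun d hd0 hd N hN => isLittleO_of_tendsto_current (hfluid d hd0 hd N hN),
    fun d hd => ⟨r₀ d, hr₀ d hd, huniq d hd, fun N hN => ?_⟩, ?_⟩
  · have h := isLittleO_of_tendsto_current (hcond d hd N hN)
    rw [condensedMin_div_varC hγ0 hγ1 hb (hr₀ d hd)] at h
    refine h.congr_left fun L => ?_
    ring
  · refine ⟨fun d => if d < dTrans γ b then d / varC γ b else r₀ d / varC γ b,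
      fun d hd0 hne N hN => ?_, dTrans γ b / varC γ b,
      (dTrans γ b - transSize γ b) / varC γ b, ?_, ?_, ?_⟩
    · rcases lt_or_gt_of_ne hne with hd | hd
      · simp only [if_pos hd]
        exact hfluid d hd0 hd N hN
      · simp only [if_neg (not_lt.2 hd.le)]
        exact hcond d hd N hN
    · have := transSize_pos hγ0 hγ1 hb
      gcongr
      linarith
    · have h : Tendsto (fun d : ℝ => d / varC γ b) (𝓝[<] (dTrans γ b))
          (𝓝 (dTrans γ b / varC γ b)) :=
        (tendsto_id.div_const _).mono_left nhdsWithin_le_nhds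
      refine h.congr' ?_
      filter_upwards [self_mem_nhdsWithin] with d hd
      have hd' : d < dTrans γ b := hd
      rw [if_pos hd']
    · have hlim : Tendsto r₀ (𝓝[>] (dTrans γ b)) (𝓝 (dTrans γ b - transSize γ b)) := by
        have hl : Tendsto (fun d : ℝ => d - transSize γ b - 2 / (1 + γ) * (d - dTrans γ b))
            (𝓝[>] (dTrans γ b)) (𝓝 (dTrans γ b - transSize γ b
              - 2 / (1 + γ) * (dTrans γ b - dTrans γ b))) :=
          ((by fun_prop : Continuous fun d : ℝ =>
            d - transSize γ b - 2 / (1 + γ) * (d - dTrans γ b)).tendsto _).mono_left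
            nhdsWithin_le_nhds
        have hu : Tendsto (fun d : ℝ => d - transSize γ b) (𝓝[>] (dTrans γ b))
            (𝓝 (dTrans γ b - transSize γ b)) :=
          (tendsto_id.sub_const _).mono_left nhdsWithin_le_nhds
        rw [sub_self, mul_zero, sub_zero] at hl
        refine tendsto_of_tendsto_of_tendsto_of_le_of_le' hl hu ?_ ?_
        · filter_upwards [self_mem_nhdsWithin] with d hd
          have := (condensate_size_bounds hγ0 hγ1 hb hd (hr₀ d hd) (hmin d hd)).2
          linarith
        · filter_upwards [self_mem_nhdsWithin] with d hd
          have := (condensate_size_bounds hγ0 hγ1 hb hd (hr₀ d hd) (hmin d hd)).1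
          linarith
      refine (hlim.div_const (varC γ b)).congr' ?_
      filter_upwards [self_mem_nhdsWithin] with d hd
      have hd' : dTrans γ b < d := hd
      rw [if_neg (not_lt.2 hd'.le)]
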